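/- Consider a stochastic bandit with $K\ge 2$ arms. In rounds $t=1,2,\dots$ the environment draws reward vectors $(r_{t,k})_{k\in[K]}\in[0,1]^K$, i.i.d. from a fixed unknown distribution with means $\mu_k$. In round $t$ an adversary, who knows $(r_{t,k})_k$ and everything that happened in earlier rounds (and may randomize), replaces it by a corrupted vector $(\widetilde r_{t,k})_{k}\in[0,1]^K$; the agent then draws an arm $I_t$, using fresh randomness, and observes only $\widetilde r_{t,I_t}$. Put $\Delta_k=\max_j\mu_j-\mu_k$, $\Delta=\min_{\Delta_k>0}\Delta_k$, $C=\mathbb E\big[\sum_{t=1}^T\max_{k}|\widetilde r_{t,k}-r_{t,k}|\big]$ and $$R(T)=\max_{k}\mathbb E\Big[\sum_{t=1}^T r_{t,k}\Big]-\mathbb E\Big[\sum_{t=1}^T r_{t,I_t}\Big].$$ The agent uses the algorithm BARBAT, which does not know $T$. Let $T_0=0$, $\Delta_k^0=1$, $r_k^0=0$ for all $k$. For epochs $m=1,2,\dots$ put $\zeta_m=(m+4)2^{2(m+4)}\ln K$, $\delta_m=1/(K\zeta_m)$, $\lambda_m=2^8\ln(4K/\delta_m)$, $\beta_m=\delta_m/K$,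 $n_k^m=\lambda_m(\Delta_k^{m-1})^{-2}$, $N_m=\lceil K\lambda_m2^{2(m-1)}\rceil$, $T_m=T_{m-1}+N_m$; let $k_m$ be the arm maximizing $r_k^{m-1}$ (of smallest index in case of ties), $\widetilde n_k^m=n_k^m$ for $k\ne k_m$ and $\widetilde n_{k_m}^m=N_m-\sum_{k\neq k_m}n_k^m$. In each round $t=T_{m-1}+1,\dots,T_m$ the agent draws $I_t$ with $\Pr[I_t=k]=\widetilde n_k^m/N_m$. At the end of the epoch, with $S_k^m=\sum_{T_{m-1}<t\le T_m,\ I_t=k}\widetilde r_{t,k}$, it sets $r_k^m=\min\{S_k^m/\widetilde n_k^m,1\}$, $r_*^m=\max_k\big\{r_k^m-\sqrt{4\ln(4/\beta_m)/\widetilde n_k^m}\big\}$ and $\Delta_k^m=\max\{2^{-m},r_*^m-r_k^m\}$. Then there is an absolute constant $A>0$ such that for every $K\ge2$, every reward distribution on $[0,1]^K$, every adversary and every $T\ge2$, $$R(T)\le A\bigg(C+\sum_{\Delta_k>0}\frac{\log(T)\log(KT)}{\Delta_k}+\frac{K\log(1/\Delta)\log(K/\Delta)}{\Delta}\bigg),$$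 where the last term is read as $0$ if all arms are optimal. -/

import Mathlib

namespace Barbat

open MeasureTheory ProbabilityTheory

noncomputable section

/-! ### The algorithm

`K` is the number of arms. Epochs are numbered `m = 1, 2, …`. Rounds are numbered `0, 1, 2, …`,
so that epoch `m` consists of the rounds `t` with `epochEnd K (m - 1) ≤ t < epochEnd K m`.
No definition refers to a time horizon. -/

/-- `ζ_m = (m + 4) 2^{2(m+4)} ln K`. -/
def zeta (K m : ℕ) : ℝ := ((m : ℝ) + 4) * 2 ^ (2 * (m + 4)) * Real.log K

/-- Failure probability `δ_m = 1 / (K ζ_m)`. -/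
def delta (K m : ℕ) : ℝ := 1 / (K * zeta K m)

/-- `λ_m = 2^8 ln (4K / δ_m)`. -/
def lam (K m : ℕ) : ℝ := 2 ^ 8 * Real.log (4 * K / delta K m)

/-- `β_m = δ_m / K`. -/
def beta (K m : ℕ) : ℝ := delta K m / K

/-- Epoch length `N_m = ⌈K λ_m 2^{2(m-1)}⌉`, for `m ≥ 1`. -/
def epochLen (K m : ℕ) : ℕ := ⌈K * lam K m * 2 ^ (2 * (m - 1))⌉₊

/-- `T_m = N_1 + ⋯ + N_m`. -/
def epochEnd (K : ℕ) : ℕ → ℕ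
  | 0 => 0
  | m + 1 => epochEnd K m + epochLen K (m + 1)

/-- What the algorithm carries from one epoch to the next: the estimated rewards `r_k^m` and the
estimated gaps `Δ_k^m`. -/
structure EpochState (K : ℕ) where
  est : Fin K → ℝ
  estGap : Fin K → ℝ

/-- `k` is the arm of maximal estimated reward, ties being broken by the smallest index. -/
def IsLeader {K : ℕ} (est : Fin K → ℝ) (k : Fin K) : Prop :=
  (∀ j, est j ≤ est k) ∧ ∀ j, j < k → est j < est k

/-- `n_k^m = λ_m (Δ_k^{m-1})^{-2}`, where `s` is the state after epoch `m - 1`. -/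
def nominalPulls {K : ℕ} (m : ℕ) (s : EpochState K) (k : Fin K) : ℝ :=
  lam K m * (s.estGap k ^ 2)⁻¹

open Classical in
/-- `ñ_k^m`: equal to `n_k^m` for arms other than the leader `k_m`, which gets all the rest of
`N_m`; `s` is the state after epoch `m - 1`. -/
def pulls {K : ℕ} (m : ℕ) (s : EpochState K) (k : Fin K) : ℝ :=
  if IsLeader s.est k then
    (epochLen K m : ℝ) - ∑ j ∈ Finset.univ.erase k, nominalPulls m s j
  else nominalPulls m s k

/-- Sampling probability `p_m(k) = ñ_k^m / N_m` during epoch `m`; `s` is the state after epoch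
`m - 1`. -/
def sampleProb {K : ℕ} (m : ℕ) (s : EpochState K) (k : Fin K) : ℝ :=
  pulls m s k / epochLen K m

/-- State of the algorithm after epoch `m`, if `a t` is the arm pulled in round `t` and `x t` is
the reward observed in round `t`. Only rounds `t < epochEnd K m` matter. -/
def state {K : ℕ} (a : ℕ → Fin K) (x : ℕ → ℝ) : ℕ → EpochState K
  | 0 => { est := fun _ => 0, estGap := fun _ => 1 }
  | m + 1 =>
    let n : Fin K → ℝ := pulls (m + 1) (state a x m)
    let total : Fin K → ℝ := fun k =>
      ∑ t ∈ Finset.Ico (epochEnd K m) (epochEnd K (m + 1)), if a t = k then x t else 0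
    let est : Fin K → ℝ := fun k => min (total k / n k) 1
    let best : ℝ := ⨆ k, (est k - Real.sqrt (4 * Real.log (4 / beta K (m + 1)) / n k))
    { est := est
      estGap := fun k => max ((2 ^ (m + 1))⁻¹) (best - est k) }

/-! ### The corrupted bandit -/

/-- Mean reward `μ_k` of arm `k` when reward vectors have law `ν`. -/
def mean {K : ℕ} (ν : Measure (Fin K → ℝ)) (k : Fin K) : ℝ := ∫ x, x k ∂ν

/-- Suboptimality gap `Δ_k = max_j μ_j - μ_k`. -/
def gap {K : ℕ} (ν : Measure (Fin K → ℝ)) (k : Fin K) : ℝ := (⨆ j, mean ν j) - mean ν k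

/-- Smallest positive gap `Δ`. If all arms are optimal there is none, and the value is `0`. -/
def minGap {K : ℕ} (ν : Measure (Fin K → ℝ)) : ℝ := sInf {d | 0 < d ∧ ∃ k, gap ν k = d}

variable {Ω : Type*} {K : ℕ}

/-- Everything that has happened before round `t`: true rewards, corrupted rewards and pulled
arms. -/
abbrev history (r c : ℕ → Ω → Fin K → ℝ) (I : ℕ → Ω → Fin K) (t : ℕ) : MeasurableSpace Ω :=
  ⨆ s, ⨆ _ : s < t, (MeasurableSpace.comap (r s) inferInstance ⊔
    MeasurableSpace.comap (c s) inferInstance ⊔ MeasurableSpace.comap (I s) inferInstance)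

/-- What is settled in round `t` before the arm is drawn: the history, the reward vector of the
round and the corrupted reward vector of the round. -/
abbrev beforePull (r c : ℕ → Ω → Fin K → ℝ) (I : ℕ → Ω → Fin K) (t : ℕ) : MeasurableSpace Ω :=
  history r c I t ⊔ MeasurableSpace.comap (r t) inferInstance ⊔
    MeasurableSpace.comap (c t) inferInstance

/-- The interaction of BARBAT with a stochastic environment of reward law `ν` and an adversary, on
the probability space `(Ω, P)`: `r t` is the true reward vector of round `t`, `c t` the corrupted
one and `I t` the arm pulled. The adversary is adaptive and possibly randomized: `c t` may depend
in any way on the history and on `r t`. The agent draws `I t` from its sampling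
distribution, which is computed from its own observations `c s (I s)`, `s < t`, only. -/
structure IsRun [MeasurableSpace Ω] (ν : Measure (Fin K → ℝ)) (P : Measure Ω)
    (r c : ℕ → Ω → Fin K → ℝ) (I : ℕ → Ω → Fin K) : Prop where
  measurable_reward : ∀ t, Measurable (r t)
  measurable_corrupted : ∀ t, Measurable (c t)
  measurable_arm : ∀ t, Measurable (I t)
  reward_law : ∀ t, P.map (r t) = ν
  reward_indep : ∀ t, Indep (MeasurableSpace.comap (r t) inferInstance) (history r c I t) P
  corrupted_mem : ∀ t, ∀ᵐ ω ∂P, ∀ k, c t ω k ∈ Set.Icc (0 : ℝ) 1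
  arm_law : ∀ m t, epochEnd K m ≤ t → t < epochEnd K (m + 1) → ∀ k,
    P[(I t ⁻¹' {k}).indicator (fun _ => (1 : ℝ)) | beforePull r c I t] =ᵐ[P]
      fun ω => sampleProb (m + 1) (state (fun s => I s ω) (fun s => c s ω (I s ω)) m) k

/-- Pseudo-regret `R(T) = max_k E[∑_t r_{t,k}] - E[∑_t r_{t,I_t}]` over the first `T` rounds. -/
def pseudoRegret [MeasurableSpace Ω] (P : Measure Ω) (r : ℕ → Ω → Fin K → ℝ)
    (I : ℕ → Ω → Fin K) (T : ℕ) : ℝ :=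
  (⨆ k, ∫ ω, ∑ t ∈ Finset.range T, r t ω k ∂P) - ∫ ω, ∑ t ∈ Finset.range T, r t ω (I t ω) ∂P

/-- Realized corruption level `C = ∑_t max_k |c_{t,k} - r_{t,k}|` of the first `T` rounds. -/
def corruption (r c : ℕ → Ω → Fin K → ℝ) (T : ℕ) (ω : Ω) : ℝ :=
  ∑ t ∈ Finset.range T, ⨆ k, |c t ω k - r t ω k|

end

end Barbat

/-! Every deviation of an estimate is charged to an error level of its epoch, so that the regret
analysis becomes pathwise and deterministic; probability enters only when error levels are averaged.

Concentration. Sampling probabilities are frozen at the start of an epoch, and the adversary commits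
before the arm is drawn. Hence `S_k / ñ_k` differs from `μ_k` by a sampling martingale, a Hoeffding
deviation of the true rewards over all `N` rounds, and at most the average corruption of the epoch,
whatever the arm. The first is at most the confidence width and the second at most `3/32 · 2^{-m}`,
except on an event of probability at most `δ_m`. With error level `g` = average corruption +
indicator of that event, the estimates are almost surely accurate in every epoch
(`accurate_of_bounds`): on the bad event `g ≥ 1`, and all quantities lie in `[0, 1]`.

Deterministic part. A width is at most `1/8` of the previous estimated gap, so errors propagate with
factor `1/8` per epoch and accumulate to the discounted sum `ρ`. The estimated gap of an arm is at
least `3/7` of its true gap, up to `3ρ`, and the leader has gap at most `2^{-m}` or at most `24ρ`.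
In one epoch the regret is therefore `O(λ ∑ 1/Δ_k) + O(N ρ)`, plus `N 2^{-m}` as long as `Δ ≤
2^{-m}` (`sum_gap_mul_pulls_le`). Epoch lengths grow by a factor at most `6 < 8`, so `∑ N ρ = O(∑ N
g)` (`sum_mul_discounted_le`).

Summation. In expectation `∑ N g` is at most the corruption plus `∑ N_m δ_m`, and `N_m δ_m ≤ 13`.
There are `O(log T)` epochs and `λ = O(log(KT))`, which gives the middle term of the bound. The
condition `Δ ≤ 2^{-m}` holds in `O(log(1/Δ))` epochs, each costing `O(K log(K/Δ)/Δ)`. The unfinished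
last epoch is harmless, because its regret is charged to errors of completed epochs. -/

namespace Barbat

open MeasureTheory ProbabilityTheory

/-! ### Logarithmic parameters and epoch lengths -/

noncomputable section

/-- The logarithmic factor `ln (4 / β_m)` of the confidence widths. -/
def confLog (K m : ℕ) : ℝ := Real.log (4 / beta K m)

theorem lam_eq (K m : ℕ) : lam K m = 256 * confLog K m := by
  unfold lam confLog beta
  rw [div_div_eq_mul_div]
  norm_num

theorem log_two_le_log {K : ℕ} (hK : 2 ≤ K) : Real.log 2 ≤ Real.log K :=
  Real.log_le_log (by norm_num) (by exact_mod_cast hK)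

theorem log_pos_of_two_le {K : ℕ} (hK : 2 ≤ K) : 0 < Real.log K :=
  lt_of_lt_of_le (Real.log_pos (by norm_num)) (log_two_le_log hK)

theorem zeta_pos {K : ℕ} (hK : 2 ≤ K) (m : ℕ) : 0 < zeta K m := by
  have := log_pos_of_two_le hK
  unfold zeta
  positivity

theorem delta_pos {K : ℕ} (hK : 2 ≤ K) (m : ℕ) : 0 < delta K m := by
  have := zeta_pos hK m
  have : (0 : ℝ) < K := by positivity
  unfold delta
  positivity

theorem beta_pos {K : ℕ} (hK : 2 ≤ K) (m : ℕ) : 0 < beta K m := by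
  have := delta_pos hK m
  have : (0 : ℝ) < K := by positivity
  unfold beta
  positivity

theorem four_div_beta {K : ℕ} (hK : 2 ≤ K) (m : ℕ) : 4 / beta K m = 4 * K ^ 2 * zeta K m := by
  have := zeta_pos hK m
  have : (0 : ℝ) < K := by positivity
  unfold beta delta
  field_simp

theorem confLog_eq {K : ℕ} (hK : 2 ≤ K) (m : ℕ) :
    confLog K m = Real.log (4 * K ^ 2 * zeta K m) := by
  rw [confLog, four_div_beta hK]

theorem exp_neg_confLog {K : ℕ} (hK : 2 ≤ K) (m : ℕ) :
    Real.exp (-confLog K m) = beta K m / 4 := by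
  have := beta_pos hK m
  rw [confLog, Real.exp_neg, Real.exp_log (by positivity), inv_div]

theorem five_le_confLog {K : ℕ} (hK : 2 ≤ K) (m : ℕ) : 5 ≤ confLog K m := by
  have h2 : (2 : ℝ) ≤ K := by exact_mod_cast hK
  have hl := log_two_le_log hK
  have hl2 := Real.log_two_gt_d9
  have hz : (256 : ℝ) ≤ zeta K m := by
    unfold zeta
    have h1 : (256 : ℝ) ≤ 2 ^ (2 * (m + 4)) := by
      calc (256 : ℝ) = 2 ^ 8 := by norm_num
        _ ≤ _ := pow_le_pow_right₀ (by norm_num) (by omega)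
    have h3 : (0 : ℝ) ≤ m := by positivity
    have h4 : (2 : ℝ) ≤ (m + 4) * Real.log K := by nlinarith
    nlinarith
  rw [confLog_eq hK]
  have : (2 : ℝ) ^ 12 ≤ 4 * K ^ 2 * zeta K m := by
    have : (4 : ℝ) ≤ K ^ 2 := by nlinarith
    nlinarith
  have h := Real.log_le_log (by norm_num) this
  rw [Real.log_pow] at h
  norm_num at h
  linarith

/-- The crude bounds `m + 4 ≤ 2^{2(m+4)}` and `ln K ≤ K` turn `4 K² ζ_m` into a pure power product.
-/
theorem confLog_le {K : ℕ} (hK : 2 ≤ K) (m : ℕ) :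
    confLog K m ≤ 3 * Real.log K + (4 * m + 18) * Real.log 2 := by
  have h0 : (0 : ℝ) < K := by positivity
  have hlK := log_pos_of_two_le hK
  have h1 : ((m : ℝ) + 4) ≤ 2 ^ (2 * (m + 4)) := by
    have h : m + 4 < 2 ^ (m + 4) := Nat.lt_two_pow_self
    have h' : ((m : ℝ) + 4) ≤ 2 ^ (m + 4) := by exact_mod_cast h.le
    exact h'.trans (pow_le_pow_right₀ (by norm_num) (by omega))
  have h2 : Real.log K ≤ K := (Real.log_le_sub_one_of_pos h0).trans (by linarith)
  have h3 : 4 * (K : ℝ) ^ 2 * zeta K m ≤ K ^ 3 * 2 ^ (4 * m + 18) := by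
    unfold zeta
    have : ((m : ℝ) + 4) * 2 ^ (2 * (m + 4)) * Real.log K
        ≤ 2 ^ (2 * (m + 4)) * 2 ^ (2 * (m + 4)) * K := by gcongr
    calc 4 * (K : ℝ) ^ 2 * (((m : ℝ) + 4) * 2 ^ (2 * (m + 4)) * Real.log K)
        ≤ 4 * K ^ 2 * (2 ^ (2 * (m + 4)) * 2 ^ (2 * (m + 4)) * K) := by gcongr
      _ = _ := by ring
  have hz := zeta_pos hK m
  rw [confLog_eq hK]
  refine (Real.log_le_log (by positivity) h3).trans_eq ?_
  rw [Real.log_mul (by positivity) (by positivity), Real.log_pow, Real.log_pow]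
  push_cast
  ring

/-- `ζ` grows by a factor at most `8` per epoch, and `ln 8 < 9/4`. -/
theorem confLog_succ_le {K : ℕ} (hK : 2 ≤ K) (m : ℕ) :
    confLog K (m + 1) ≤ confLog K m + 9 / 4 := by
  have h0 : (0 : ℝ) < K := by positivity
  have hz := zeta_pos hK m
  have hlK := log_pos_of_two_le hK
  have h1 : zeta K (m + 1) ≤ 2 ^ 3 * zeta K m := by
    unfold zeta
    push_cast
    have : (2 : ℝ) ^ (2 * (m + 1 + 4)) = 4 * 2 ^ (2 * (m + 4)) := by ring
    rw [this]
    have h3 : (0 : ℝ) ≤ m := by positivity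
    have : 0 < (2 : ℝ) ^ (2 * (m + 4)) * Real.log K := by positivity
    nlinarith
  rw [confLog_eq hK, confLog_eq hK]
  have hz' := zeta_pos hK (m + 1)
  have : 4 * (K : ℝ) ^ 2 * zeta K (m + 1) ≤ (4 * K ^ 2 * zeta K m) * 2 ^ 3 := by
    have : 0 < 4 * (K : ℝ) ^ 2 := by positivity
    nlinarith
  refine (Real.log_le_log (by positivity) this).trans ?_
  rw [Real.log_mul (by positivity) (by positivity), Real.log_pow]
  have := Real.log_two_lt_d9
  norm_num
  linarith

theorem two_pow_two_mul (m : ℕ) : (2 : ℝ) ^ (2 * m) = 4 ^ m := by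
  rw [pow_mul]; norm_num

theorem le_epochLen (K m : ℕ) : K * lam K (m + 1) * 4 ^ m ≤ epochLen K (m + 1) := by
  unfold epochLen
  refine le_trans (le_of_eq ?_) (Nat.le_ceil _)
  rw [Nat.add_sub_cancel, two_pow_two_mul]

theorem lam_pos {K : ℕ} (hK : 2 ≤ K) (m : ℕ) : 0 < lam K m := by
  rw [lam_eq]; linarith [five_le_confLog hK m]

theorem epochLen_lt {K : ℕ} (hK : 2 ≤ K) (m : ℕ) :
    epochLen K (m + 1) < K * lam K (m + 1) * 4 ^ m + 1 := by
  have := lam_pos hK (m + 1)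
  unfold epochLen
  refine lt_of_lt_of_eq (Nat.ceil_lt_add_one (by positivity)) ?_
  rw [Nat.add_sub_cancel, two_pow_two_mul]

theorem one_le_mul_lam {K : ℕ} (hK : 2 ≤ K) (m n : ℕ) : 1 ≤ K * lam K m * 4 ^ n := by
  have h2 : (2 : ℝ) ≤ K := by exact_mod_cast hK
  have h5 := five_le_confLog hK m
  have h1 : (1 : ℝ) ≤ 4 ^ n := one_le_pow₀ (by norm_num)
  have h3 : 1 ≤ K * lam K m := by rw [lam_eq]; nlinarith
  nlinarith

theorem epochLen_le {K : ℕ} (hK : 2 ≤ K) (m : ℕ) :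
    (epochLen K (m + 1) : ℝ) ≤ 2 * (K * lam K (m + 1) * 4 ^ m) := by
  linarith [epochLen_lt hK m, one_le_mul_lam hK (m + 1) m]

theorem epochLen_pos {K : ℕ} (hK : 2 ≤ K) (m : ℕ) : (0 : ℝ) < epochLen K (m + 1) := by
  linarith [le_epochLen K m, one_le_mul_lam hK (m + 1) m]

/-- Since the logarithm is at least `5` and grows by at most `9/4`, the ratio is at most `4 · 1.45 =
5.8` before rounding; the slack absorbs the ceiling. What matters later is that `6` is below `8`,
the rate at which old errors are discounted. -/
theorem epochLen_succ_le {K : ℕ} (hK : 2 ≤ K) (m : ℕ) :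
    (epochLen K (m + 2) : ℝ) ≤ 6 * epochLen K (m + 1) := by
  have h1 := epochLen_lt hK (m + 1)
  have h2 := le_epochLen K m
  have h5 := five_le_confLog hK (m + 1)
  have h6 := confLog_succ_le hK (m + 1)
  have hK' : (2 : ℝ) ≤ K := by exact_mod_cast hK
  have h7 : (1 : ℝ) ≤ 4 ^ m := one_le_pow₀ (by norm_num)
  have hX : 2 ≤ K * (4 : ℝ) ^ m := by nlinarith
  rw [lam_eq] at h1 h2
  have e1 : K * (256 * confLog K (m + 1 + 1)) * (4 : ℝ) ^ (m + 1)
      = 1024 * (K * 4 ^ m * confLog K (m + 1 + 1)) := by ring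
  have e2 : K * (256 * confLog K (m + 1)) * (4 : ℝ) ^ m
      = 256 * (K * 4 ^ m * confLog K (m + 1)) := by ring
  rw [e1] at h1
  rw [e2] at h2
  have h8 : K * (4 : ℝ) ^ m * confLog K (m + 1 + 1)
      ≤ K * (4 : ℝ) ^ m * (confLog K (m + 1) + 9 / 4) :=
    mul_le_mul_of_nonneg_left h6 (by linarith)
  have h9 : K * (4 : ℝ) ^ m * 5 ≤ K * (4 : ℝ) ^ m * confLog K (m + 1) :=
    mul_le_mul_of_nonneg_left h5 (by linarith)
  have h10 : (epochLen K (m + 2) : ℝ) = epochLen K (m + 1 + 1) := rfl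
  linarith

/-- `N_m` is of order `K λ_m 4^m` and `λ_m` of order at most `m ln K`, which the factor `(m + 4) ln
K` in `ζ_m` compensates. A failed epoch thus costs a bounded amount on average. -/
theorem epochLen_mul_delta_le {K : ℕ} (hK : 2 ≤ K) (m : ℕ) :
    epochLen K (m + 1) * delta K (m + 1) ≤ 13 := by
  have h0 : (0 : ℝ) < K := by positivity
  have hl := log_two_le_log hK
  have hlK := log_pos_of_two_le hK
  have hz := zeta_pos hK (m + 1)
  have hc := confLog_le hK (m + 1)
  have hm : (0 : ℝ) ≤ m := by positivity
  have hc' : confLog K (m + 1) ≤ (4 * m + 25) * Real.log K := by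
    push_cast at hc
    nlinarith
  unfold delta
  rw [mul_one_div, div_le_iff₀ (by positivity)]
  refine (epochLen_le hK m).trans ?_
  rw [lam_eq]
  unfold zeta
  push_cast
  rw [two_pow_two_mul]
  have e : (4 : ℝ) ^ (m + 1 + 4) = 1024 * 4 ^ m := by ring
  rw [e]
  have : 512 * confLog K (m + 1) ≤ 13 * 1024 * ((m + 5) * Real.log K) := by nlinarith
  calc 2 * (K * (256 * confLog K (m + 1)) * (4 : ℝ) ^ m)
      = (K * 4 ^ m) * (512 * confLog K (m + 1)) := by ring
    _ ≤ (K * 4 ^ m) * (13 * 1024 * ((m + 5) * Real.log K)) := by gcongr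
    _ = _ := by ring

end

/-! ### Pull counts, sampling probabilities and the state recursion -/

noncomputable section

variable {K : ℕ}

theorem exists_isLeader (hK : 2 ≤ K) (est : Fin K → ℝ) : ∃ k, IsLeader est k := by
  classical
  have : Nonempty (Fin K) := ⟨⟨0, by omega⟩⟩
  let S : Finset (Fin K) := Finset.univ.filter fun k => ∀ j, est j ≤ est k
  have hS : S.Nonempty := by
    obtain ⟨k, hk⟩ := Finite.exists_max est
    exact ⟨k, by simpa [S] using hk⟩
  have hmem : ∀ j, est j ≤ est (S.min' hS) := by simpa [S] using S.min'_mem hS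
  refine ⟨S.min' hS, hmem, fun j hj => lt_of_not_ge fun h => ?_⟩
  have hjS : j ∈ S := by
    simp only [S, Finset.mem_filter, Finset.mem_univ, true_and]
    exact fun i => (hmem i).trans h
  exact absurd (S.min'_le j hjS) (not_le.mpr hj)

theorem IsLeader.unique {est : Fin K → ℝ} {j k : Fin K} (hj : IsLeader est j)
    (hk : IsLeader est k) : j = k := by
  rcases lt_trichotomy j k with h | h | h
  · exact absurd (hk.2 j h) (not_lt.mpr (hj.1 k))
  · exact h
  · exact absurd (hj.2 k h) (not_lt.mpr (hk.1 j))

theorem nominalPulls_nonneg (hK : 2 ≤ K) (m : ℕ) (s : EpochState K) (k : Fin K) :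
    0 ≤ nominalPulls m s k := by
  have := lam_pos hK m
  unfold nominalPulls
  positivity

theorem nominalPulls_le (hK : 2 ≤ K) {m : ℕ} {s : EpochState K} {k : Fin K}
    (h : ((2 : ℝ) ^ m)⁻¹ ≤ s.estGap k) :
    nominalPulls (m + 1) s k ≤ lam K (m + 1) * 4 ^ m := by
  have := lam_pos hK (m + 1)
  unfold nominalPulls
  have h4 : ((4 : ℝ) ^ m)⁻¹ ≤ s.estGap k ^ 2 := by
    rw [← two_pow_two_mul, mul_comm, pow_mul, ← inv_pow]
    exact pow_le_pow_left₀ (by positivity) h 2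
  gcongr
  exact inv_le_of_inv_le₀ (by positivity) h4

theorem le_nominalPulls (hK : 2 ≤ K) (m : ℕ) {s : EpochState K} {k : Fin K}
    (h0 : 0 < s.estGap k) (h1 : s.estGap k ≤ 1) : lam K m ≤ nominalPulls m s k := by
  have := lam_pos hK m
  have : s.estGap k ^ 2 ≤ 1 := pow_le_one₀ h0.le h1
  unfold nominalPulls
  exact le_mul_of_one_le_right (by linarith) ((one_le_inv₀ (by positivity)).2 this)

theorem pulls_of_isLeader {m : ℕ} {s : EpochState K} {k : Fin K} (hk : IsLeader s.est k) :
    pulls m s k = (epochLen K m : ℝ) - ∑ j ∈ Finset.univ.erase k, nominalPulls m s j := by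
  simp [pulls, hk]

theorem pulls_of_not_isLeader {m : ℕ} {s : EpochState K} {k : Fin K} (hk : ¬ IsLeader s.est k) :
    pulls m s k = nominalPulls m s k := by
  simp [pulls, hk]

/-- The other `K - 1` arms take at most `λ 4^m` each out of `N ≥ K λ 4^m`. This makes the sampling
probabilities a genuine distribution. -/
theorem le_pulls_of_isLeader (hK : 2 ≤ K) {m : ℕ} {s : EpochState K}
    (h : ∀ k, ((2 : ℝ) ^ m)⁻¹ ≤ s.estGap k) {k : Fin K} (hk : IsLeader s.est k) :
    lam K (m + 1) * 4 ^ m ≤ pulls (m + 1) s k := by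
  rw [pulls_of_isLeader hk]
  have h1 : ∑ j ∈ Finset.univ.erase k, nominalPulls (m + 1) s j
      ≤ ∑ j ∈ Finset.univ.erase k, lam K (m + 1) * 4 ^ m :=
    Finset.sum_le_sum fun j _ => nominalPulls_le hK (h j)
  rw [Finset.sum_const, Finset.card_erase_of_mem (Finset.mem_univ _), Finset.card_univ,
    Fintype.card_fin, nsmul_eq_mul, Nat.cast_sub (by omega)] at h1
  have h2 := le_epochLen K m
  push_cast at h1
  linarith

theorem nominalPulls_le_pulls (hK : 2 ≤ K) {m : ℕ} {s : EpochState K}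
    (h : ∀ k, ((2 : ℝ) ^ m)⁻¹ ≤ s.estGap k) (k : Fin K) :
    nominalPulls (m + 1) s k ≤ pulls (m + 1) s k := by
  by_cases hk : IsLeader s.est k
  · exact (nominalPulls_le hK (h k)).trans (le_pulls_of_isLeader hK h hk)
  · exact (pulls_of_not_isLeader hk).ge

theorem pulls_pos (hK : 2 ≤ K) {m : ℕ} {s : EpochState K}
    (h : ∀ k, ((2 : ℝ) ^ m)⁻¹ ≤ s.estGap k) (k : Fin K) : 0 < pulls (m + 1) s k := by
  refine lt_of_lt_of_le ?_ (nominalPulls_le_pulls hK h k)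
  have := lam_pos hK (m + 1)
  have : 0 < s.estGap k := lt_of_lt_of_le (by positivity) (h k)
  unfold nominalPulls
  positivity

theorem sum_pulls (hK : 2 ≤ K) (m : ℕ) (s : EpochState K) : ∑ k, pulls m s k = epochLen K m := by
  obtain ⟨l, hl⟩ := exists_isLeader hK s.est
  rw [← Finset.add_sum_erase _ _ (Finset.mem_univ l), pulls_of_isLeader hl]
  have : ∑ j ∈ Finset.univ.erase l, pulls m s j
      = ∑ j ∈ Finset.univ.erase l, nominalPulls m s j :=
    Finset.sum_congr rfl fun j hj => pulls_of_not_isLeader fun h =>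
      Finset.ne_of_mem_erase hj (h.unique hl)
  rw [this]
  ring

theorem pulls_le (hK : 2 ≤ K) {m : ℕ} {s : EpochState K}
    (h : ∀ k, ((2 : ℝ) ^ m)⁻¹ ≤ s.estGap k) (k : Fin K) :
    pulls (m + 1) s k ≤ epochLen K (m + 1) := by
  rw [← sum_pulls hK (m + 1) s]
  exact Finset.single_le_sum (fun j _ => (pulls_pos hK h j).le) (Finset.mem_univ k)

theorem sum_sampleProb (hK : 2 ≤ K) (m : ℕ) (s : EpochState K) :
    ∑ k, sampleProb (m + 1) s k = 1 := by
  unfold sampleProb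
  rw [← Finset.sum_div, sum_pulls hK, div_self (epochLen_pos hK m).ne']

theorem sampleProb_pos (hK : 2 ≤ K) {m : ℕ} {s : EpochState K}
    (h : ∀ k, ((2 : ℝ) ^ m)⁻¹ ≤ s.estGap k) (k : Fin K) : 0 < sampleProb (m + 1) s k :=
  div_pos (pulls_pos hK h k) (epochLen_pos hK m)

theorem sampleProb_le_one (hK : 2 ≤ K) {m : ℕ} {s : EpochState K}
    (h : ∀ k, ((2 : ℝ) ^ m)⁻¹ ≤ s.estGap k) (k : Fin K) : sampleProb (m + 1) s k ≤ 1 :=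
  (div_le_one (epochLen_pos hK m)).2 (pulls_le hK h k)

theorem sampleProb_mul_epochLen (hK : 2 ≤ K) (m : ℕ) (s : EpochState K) (k : Fin K) :
    sampleProb (m + 1) s k * epochLen K (m + 1) = pulls (m + 1) s k :=
  div_mul_cancel₀ _ (epochLen_pos hK m).ne'

section State

variable (a : ℕ → Fin K) (x : ℕ → ℝ)

/-- `S_k` in epoch `m + 1`: the total reward observed from arm `k`. -/
def epochTotal (m : ℕ) (k : Fin K) : ℝ :=
  ∑ t ∈ Finset.Ico (epochEnd K m) (epochEnd K (m + 1)), if a t = k then x t else 0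

/-- Confidence width of arm `k` at the end of epoch `m + 1`. -/
def width (m : ℕ) (k : Fin K) : ℝ :=
  Real.sqrt (4 * confLog K (m + 1) / pulls (m + 1) (state a x m) k)

theorem state_succ_est (m : ℕ) (k : Fin K) : (state a x (m + 1)).est k
    = min (epochTotal a x m k / pulls (m + 1) (state a x m) k) 1 := rfl

theorem state_succ_estGap (m : ℕ) (k : Fin K) : (state a x (m + 1)).estGap k
    = max ((2 ^ (m + 1))⁻¹)
      ((⨆ j, ((state a x (m + 1)).est j - width a x m j)) - (state a x (m + 1)).est k) := rfl

theorem le_state_estGap (m : ℕ) (k : Fin K) : ((2 : ℝ) ^ m)⁻¹ ≤ (state a x m).estGap k := by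
  cases m with
  | zero => simp [state]
  | succ m => rw [state_succ_estGap]; exact le_max_left _ _

theorem state_estGap_pos (m : ℕ) (k : Fin K) : 0 < (state a x m).estGap k :=
  lt_of_lt_of_le (by positivity) (le_state_estGap a x m k)

theorem state_est_le_one (m : ℕ) (k : Fin K) : (state a x m).est k ≤ 1 := by
  cases m with
  | zero => simp [state]
  | succ m => rw [state_succ_est]; exact min_le_right _ _

theorem state_est_nonneg (hK : 2 ≤ K) (hx : ∀ t, 0 ≤ x t) (m : ℕ) (k : Fin K) :
    0 ≤ (state a x m).est k := by
  cases m with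
  | zero => simp [state]
  | succ m =>
    rw [state_succ_est]
    refine le_min (div_nonneg (Finset.sum_nonneg fun t _ => ?_)
      (pulls_pos hK (le_state_estGap a x m) k).le) zero_le_one
    split_ifs
    exacts [hx t, le_rfl]

theorem state_estGap_le_one (hK : 2 ≤ K) (hx : ∀ t, 0 ≤ x t) (m : ℕ) (k : Fin K) :
    (state a x m).estGap k ≤ 1 := by
  have : Nonempty (Fin K) := ⟨k⟩
  cases m with
  | zero => simp [state]
  | succ m =>
    rw [state_succ_estGap]
    refine max_le (inv_le_one_of_one_le₀ (one_le_pow₀ (by norm_num))) ?_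
    have h1 : (⨆ j, ((state a x (m + 1)).est j - width a x m j)) ≤ 1 :=
      ciSup_le fun j => by
        have := state_est_le_one a x (m + 1) j
        have : 0 ≤ width a x m j := Real.sqrt_nonneg _
        linarith
    linarith [state_est_nonneg a x hK hx (m + 1) k]

/-- The factor `256 = 4 · 8²` in `λ` is chosen for this: with `n_k = λ / Δ_k²` the squared width is
at most `4 L / n_k = Δ_k² / 64`, where `L` is the confidence logarithm. -/
theorem width_le (hK : 2 ≤ K) (m : ℕ) (k : Fin K) :
    width a x m k ≤ (state a x m).estGap k / 8 := by
  have hpos := state_estGap_pos a x m k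
  have hL := five_le_confLog hK (m + 1)
  unfold width
  rw [Real.sqrt_le_left (by positivity)]
  have h1 := nominalPulls_le_pulls hK (le_state_estGap a x m) k
  have h2 : 0 < nominalPulls (m + 1) (state a x m) k := by
    have := lam_pos hK (m + 1)
    unfold nominalPulls
    positivity
  calc 4 * confLog K (m + 1) / pulls (m + 1) (state a x m) k
      ≤ 4 * confLog K (m + 1) / nominalPulls (m + 1) (state a x m) k := by gcongr
    _ = _ := by
      unfold nominalPulls
      rw [lam_eq]
      field_simp
      norm_num

end State

end

/-! ### Deterministic regret analysis under accurate estimates -/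

noncomputable section

variable {K : ℕ}

/-- Discounted sum `ρ_m = ∑_{i < m} 8^{-(m - 1 - i)} g_i` of the errors `g_i` made in epoch
`i + 1`. -/
def discounted (g : ℕ → ℝ) : ℕ → ℝ
  | 0 => 0
  | m + 1 => g m + discounted g m / 8

theorem discounted_nonneg {g : ℕ → ℝ} (hg : ∀ m, 0 ≤ g m) (m : ℕ) : 0 ≤ discounted g m := by
  induction m with
  | zero => exact le_rfl
  | succ m ih => have := hg m; simp only [discounted]; positivity

/-- Summing `N_{m+1} ρ_m` costs no more than a constant times `∑ N_{i+1} g_i`. -/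
theorem sum_mul_discounted_le {N g : ℕ → ℝ} (hN : ∀ m, 0 ≤ N m)
    (hN' : ∀ m, N (m + 1) ≤ 6 * N m) (hg : ∀ m, 0 ≤ g m) (M : ℕ) :
    ∑ m ∈ Finset.range M, N (m + 1) * discounted g (m + 1)
      ≤ 24 * ∑ m ∈ Finset.range M, N m * g m := by
  -- The extra term is a potential: the left side grows by at most `4 N_{M+1} ρ_{M+1}`, minus the
  -- old potential `3 N_M ρ_M`, and `4 (6 N_M g_M + 3/4 N_M ρ_M) = 24 N_M g_M + 3 N_M ρ_M`.
  have key : ∑ m ∈ Finset.range M, N (m + 1) * discounted g (m + 1) + 3 * (N M * discounted g M)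
      ≤ 24 * ∑ m ∈ Finset.range M, N m * g m := by
    induction M with
    | zero => simp [discounted]
    | succ M ih =>
      rw [Finset.sum_range_succ, Finset.sum_range_succ]
      have h0 := discounted_nonneg hg (M + 1)
      have h1 : N (M + 1) * discounted g (M + 1) ≤ 6 * N M * discounted g (M + 1) :=
        mul_le_mul_of_nonneg_right (hN' M) h0
      have h2 : 6 * N M * discounted g (M + 1) = 6 * (N M * g M) + 3 / 4 * (N M * discounted g M) := by
        simp only [discounted]; ring
      linarith
  have : 0 ≤ N M * discounted g M := mul_nonneg (hN M) (discounted_nonneg hg M)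
  linarith

section Deterministic

variable {a : ℕ → Fin K} {x : ℕ → ℝ} {μ : Fin K → ℝ} {g : ℕ → ℝ}

/-- The estimates of epoch `m + 1` are accurate up to the confidence widths and an error `g m`. -/
def Accurate (a : ℕ → Fin K) (x : ℕ → ℝ) (μ : Fin K → ℝ) (g : ℕ → ℝ) (m : ℕ) : Prop :=
  ∀ k, |(state a x (m + 1)).est k - μ k| ≤ g m + 3 / 32 * (2 ^ (m + 1))⁻¹ + width a x m k

/-- The widths subtracted in `r_*` cancel those in the errors of the competing arms, so only the
width of arm `k` itself remains. -/
theorem Accurate.estGap_le (hK : 2 ≤ K) {m : ℕ} (h : Accurate a x μ g m) {b : Fin K}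
    (hb : ∀ j, μ j ≤ μ b) (k : Fin K) :
    (state a x (m + 1)).estGap k ≤ max ((2 ^ (m + 1))⁻¹)
      (μ b - μ k + 2 * g m + 3 / 16 * (2 ^ (m + 1))⁻¹ + (state a x m).estGap k / 8) := by
  have : Nonempty (Fin K) := ⟨k⟩
  rw [state_succ_estGap]
  refine max_le_max le_rfl ?_
  have h1 : (⨆ j, ((state a x (m + 1)).est j - width a x m j))
      ≤ μ b + g m + 3 / 32 * (2 ^ (m + 1))⁻¹ :=
    ciSup_le fun j => by
      have := abs_le.1 (h j)
      linarith [hb j, this.2]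
  have h2 := abs_le.1 (h k)
  have h3 := width_le a x hK m k
  linarith [h2.1]

/-- Here arm `b` competes in `r_*`. Its width counts twice, once as error and once as subtracted
penalty, whence `1/4` instead of `1/8`. -/
theorem Accurate.le_estGap (hK : 2 ≤ K) {m : ℕ} (h : Accurate a x μ g m) (b k : Fin K) :
    μ b - μ k - 2 * g m - 3 / 16 * (2 ^ (m + 1))⁻¹ - (state a x m).estGap b / 4
      - (state a x m).estGap k / 8 ≤ (state a x (m + 1)).estGap k := by
  rw [state_succ_estGap]
  refine le_trans ?_ (le_max_right _ _)
  have h1 : (state a x (m + 1)).est b - width a x m b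
      ≤ ⨆ j, ((state a x (m + 1)).est j - width a x m j) :=
    le_ciSup (f := fun j => (state a x (m + 1)).est j - width a x m j)
      (Set.finite_range _).bddAbove b
  have hk := abs_le.1 (h k)
  have hb := abs_le.1 (h b)
  linarith [hk.2, hb.1, width_le a x hK m k, width_le a x hK m b]

theorem Accurate.leader_gap_le (hK : 2 ≤ K) {m : ℕ} (h : Accurate a x μ g m) {l : Fin K}
    (hl : IsLeader (state a x (m + 1)).est l) (b : Fin K) :
    μ b - μ l ≤ 2 * g m + 3 / 16 * (2 ^ (m + 1))⁻¹
      + ((state a x m).estGap l + (state a x m).estGap b) / 8 := by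
  have h1 := hl.1 b
  have hk := abs_le.1 (h l)
  have hb := abs_le.1 (h b)
  linarith [hk.2, hb.1, width_le a x hK m l, width_le a x hK m b]

theorem two_pow_succ_inv (m : ℕ) : ((2 : ℝ) ^ m)⁻¹ = 2 * ((2 : ℝ) ^ (m + 1))⁻¹ := by
  rw [pow_succ]; field_simp

/-- The coefficient `8/7` is the fixed point of `x = 1 + x/8`. -/
theorem estGap_le_discounted (hK : 2 ≤ K) (hg : ∀ m, 0 ≤ g m) {m : ℕ}
    (h : ∀ i < m, Accurate a x μ g i) {b : Fin K} (hb : ∀ j, μ j ≤ μ b) (k : Fin K) :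
    (state a x m).estGap k ≤ 8 / 7 * (μ b - μ k) + 2 * discounted g m + (2 ^ m)⁻¹ := by
  induction m with
  | zero =>
    have := hb k
    simp only [state, discounted, pow_zero]
    linarith
  | succ m ih =>
    have ih' := ih fun i hi => h i (by omega)
    have h1 := (h m (by omega)).estGap_le hK hb k
    have h2 := discounted_nonneg hg (m + 1)
    have h3 := hb k
    refine h1.trans (max_le (by linarith) ?_)
    rw [two_pow_succ_inv m] at ih'
    have h4 : (0 : ℝ) < (2 ^ (m + 1))⁻¹ := by positivity
    simp only [discounted]
    linarith

/-- The one-step bound yields `6/7` of the gap, minus errors and `15/16 · 2^{-(m+1)}`. As the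
estimated gap is itself at least `2^{-(m+1)}`, the last term is absorbed at the price of halving. -/
theorem le_estGap_discounted (hK : 2 ≤ K) (hg : ∀ m, 0 ≤ g m) {m : ℕ}
    (h : ∀ i < m + 1, Accurate a x μ g i) {b : Fin K} (hb : ∀ j, μ j ≤ μ b) (k : Fin K) :
    3 / 7 * (μ b - μ k) - 3 * discounted g (m + 1) ≤ (state a x (m + 1)).estGap k := by
  have h' : ∀ i < m, Accurate a x μ g i := fun i hi => h i (by omega)
  have h1 := (h m (by omega)).le_estGap hK b k
  have h2 := estGap_le_discounted hK hg h' hb k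
  have h3 := estGap_le_discounted hK hg h' hb b
  have h4 := le_state_estGap a x (m + 1) k
  have h5 := discounted_nonneg hg m
  have h6 := hg m
  rw [two_pow_succ_inv m] at h2 h3
  have h7 : (0 : ℝ) < (2 ^ (m + 1))⁻¹ := by positivity
  simp only [discounted]
  linarith

/-- With `u = 2^{-(m+1)}`, the gap `d` of the leader satisfies `6/7 d ≤ 2 g + ρ/2 + 11/16 u`. If `d
> u`, the term in `u` is absorbed on the left, leaving the coefficient `19/112`. -/
theorem leader_gap_le_discounted (hK : 2 ≤ K) (hg : ∀ m, 0 ≤ g m) {m : ℕ}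
    (h : ∀ i < m + 1, Accurate a x μ g i) {b : Fin K} (hb : ∀ j, μ j ≤ μ b) {l : Fin K}
    (hl : IsLeader (state a x (m + 1)).est l) :
    μ b - μ l ≤ (2 ^ (m + 1))⁻¹ ∨ μ b - μ l ≤ 24 * discounted g (m + 1) := by
  have h' : ∀ i < m, Accurate a x μ g i := fun i hi => h i (by omega)
  have h1 := (h m (by omega)).leader_gap_le hK hl b
  have h2 := estGap_le_discounted hK hg h' hb l
  have h3 := estGap_le_discounted hK hg h' hb b
  have h5 := discounted_nonneg hg m
  have h6 := hg m
  rw [two_pow_succ_inv m] at h2 h3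
  rw [or_iff_not_imp_left, not_le]
  intro h7
  simp only [discounted]
  linarith

/-- Pulls of an arm times its gap, not counting the surplus of the leader. -/
theorem gap_mul_nominalPulls_le (hK : 2 ≤ K) (hg : ∀ m, 0 ≤ g m) {m : ℕ}
    (h : ∀ i < m + 1, Accurate a x μ g i) {b : Fin K} (hb : ∀ j, μ j ≤ μ b) (k : Fin K) :
    (μ b - μ k) * nominalPulls (m + 2) (state a x (m + 1)) k
      ≤ (if 0 < μ b - μ k then 22 * lam K (m + 2) / (μ b - μ k) else 0)
        + 14 * (lam K (m + 2) * 4 ^ (m + 1)) * discounted g (m + 1) := by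
  have hlam := lam_pos hK (m + 2)
  have hρ := discounted_nonneg hg (m + 1)
  have hn := nominalPulls_nonneg hK (m + 2) (state a x (m + 1)) k
  have hX : 0 ≤ 14 * (lam K (m + 2) * 4 ^ (m + 1)) * discounted g (m + 1) := by positivity
  split_ifs with hd
  -- Above the threshold `14ρ` the error `3ρ` uses at most half of `3/7` of the gap, so the
  -- estimated gap is at least `3/14` of it and `(14/3)² < 22`. Below it, the cap `λ 4^{m+1}` on the
  -- pulls suffices.
  · rcases le_or_gt (14 * discounted g (m + 1)) (μ b - μ k) with hc | hc
    · have h1 := le_estGap_discounted hK hg h hb k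
      have h2 : 3 / 14 * (μ b - μ k) ≤ (state a x (m + 1)).estGap k := by linarith
      have h3 : (3 / 14 * (μ b - μ k)) ^ 2 ≤ (state a x (m + 1)).estGap k ^ 2 :=
        pow_le_pow_left₀ (by positivity) h2 2
      have h4 : nominalPulls (m + 2) (state a x (m + 1)) k
          ≤ lam K (m + 2) * ((3 / 14 * (μ b - μ k)) ^ 2)⁻¹ := by
        unfold nominalPulls
        gcongr
      have h5 : (μ b - μ k) * (lam K (m + 2) * ((3 / 14 * (μ b - μ k)) ^ 2)⁻¹)
          ≤ 22 * lam K (m + 2) / (μ b - μ k) := by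
        rw [le_div_iff₀ hd]
        have : (μ b - μ k) * (lam K (m + 2) * ((3 / 14 * (μ b - μ k)) ^ 2)⁻¹) * (μ b - μ k)
            = 196 / 9 * lam K (m + 2) := by
          field_simp
          norm_num
        linarith
      have := mul_le_mul_of_nonneg_left h4 hd.le
      linarith
    · have h4 : nominalPulls (m + 2) (state a x (m + 1)) k ≤ lam K (m + 2) * 4 ^ (m + 1) :=
        nominalPulls_le hK (le_state_estGap a x (m + 1) k)
      have h5 : 0 ≤ 22 * lam K (m + 2) / (μ b - μ k) := by positivity
      have : (μ b - μ k) * nominalPulls (m + 2) (state a x (m + 1)) k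
          ≤ (14 * discounted g (m + 1)) * (lam K (m + 2) * 4 ^ (m + 1)) := by gcongr
      linarith
  · have : μ b - μ k = 0 := le_antisymm (not_lt.1 hd) (by linarith [hb k])
    rw [this]
    linarith

/-- Regret of epoch `m + 2`, given the errors made in the epochs before it. -/
theorem sum_gap_mul_pulls_le (hK : 2 ≤ K) (hg : ∀ m, 0 ≤ g m) {m : ℕ}
    (h : ∀ i < m + 1, Accurate a x μ g i) {b : Fin K} (hb : ∀ j, μ j ≤ μ b) {D : ℝ}
    (hD : ∀ k, 0 < μ b - μ k → D ≤ μ b - μ k) :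
    ∑ k, (μ b - μ k) * pulls (m + 2) (state a x (m + 1)) k
      ≤ 22 * lam K (m + 2) * ∑ k with 0 < μ b - μ k, 1 / (μ b - μ k)
        + 38 * (epochLen K (m + 2) * discounted g (m + 1))
        + (if D ≤ (2 ^ (m + 1))⁻¹ then epochLen K (m + 2) * ((2 : ℝ) ^ (m + 1))⁻¹ else 0) := by
  obtain ⟨l, hl⟩ := exists_isLeader hK (state a x (m + 1)).est
  have hρ := discounted_nonneg hg (m + 1)
  have hN : (0 : ℝ) < epochLen K (m + 2) := epochLen_pos hK (m + 1)
  have h1 : ∑ k, (μ b - μ k) * pulls (m + 2) (state a x (m + 1)) k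
      ≤ ∑ k, (μ b - μ k) * nominalPulls (m + 2) (state a x (m + 1)) k
        + (μ b - μ l) * epochLen K (m + 2) := by
    rw [← Finset.add_sum_erase _ (fun k => (μ b - μ k) * pulls (m + 2) (state a x (m + 1)) k)
      (Finset.mem_univ l), ← Finset.add_sum_erase _
      (fun k => (μ b - μ k) * nominalPulls (m + 2) (state a x (m + 1)) k) (Finset.mem_univ l)]
    have e : ∑ k ∈ Finset.univ.erase l, (μ b - μ k) * pulls (m + 2) (state a x (m + 1)) k
        = ∑ k ∈ Finset.univ.erase l, (μ b - μ k) * nominalPulls (m + 2) (state a x (m + 1)) k :=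
      Finset.sum_congr rfl fun k hk => by
        rw [pulls_of_not_isLeader fun h => Finset.ne_of_mem_erase hk (h.unique hl)]
    have h2 : (μ b - μ l) * pulls (m + 2) (state a x (m + 1)) l
        ≤ (μ b - μ l) * epochLen K (m + 2) :=
      mul_le_mul_of_nonneg_left (pulls_le hK (le_state_estGap a x (m + 1)) l)
        (by linarith [hb l])
    have h3 : 0 ≤ (μ b - μ l) * nominalPulls (m + 2) (state a x (m + 1)) l :=
      mul_nonneg (by linarith [hb l]) (nominalPulls_nonneg hK _ _ _)
    linarith
  have h2 : ∑ k, (μ b - μ k) * nominalPulls (m + 2) (state a x (m + 1)) k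
      ≤ 22 * lam K (m + 2) * ∑ k with 0 < μ b - μ k, 1 / (μ b - μ k)
        + 14 * (epochLen K (m + 2) * discounted g (m + 1)) := by
    refine (Finset.sum_le_sum fun k _ => gap_mul_nominalPulls_le hK hg h hb k).trans ?_
    rw [Finset.sum_add_distrib, Finset.sum_const, Finset.card_univ, Fintype.card_fin,
      nsmul_eq_mul, ← Finset.sum_filter, Finset.mul_sum]
    refine add_le_add (le_of_eq (Finset.sum_congr rfl fun k _ => by ring)) ?_
    have := mul_le_mul_of_nonneg_right (le_epochLen K (m + 1)) hρ
    linarith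
  have h3 : (μ b - μ l) * epochLen K (m + 2) ≤ 24 * (epochLen K (m + 2) * discounted g (m + 1))
      + (if D ≤ (2 ^ (m + 1))⁻¹ then epochLen K (m + 2) * ((2 : ℝ) ^ (m + 1))⁻¹ else 0) := by
    have hX : 0 ≤ epochLen K (m + 2) * discounted g (m + 1) := by positivity
    have hY : 0 ≤ (if D ≤ (2 ^ (m + 1))⁻¹ then epochLen K (m + 2) * ((2 : ℝ) ^ (m + 1))⁻¹
        else 0) := by positivity
    rcases leader_gap_le_discounted hK hg h hb hl with hc | hc
    · rcases (sub_nonneg.2 (hb l)).eq_or_lt with h0 | h0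
      · rw [← h0]; linarith
      · rw [if_pos ((hD l h0).trans hc)]
        have := mul_le_mul_of_nonneg_right hc hN.le
        linarith
    · have := mul_le_mul_of_nonneg_right hc hN.le
      linarith
  linarith

/-- Regret of the first epoch. -/
theorem sum_gap_mul_pulls_first_le (hK : 2 ≤ K) {b : Fin K} (hb : ∀ j, μ j ≤ μ b)
    (h1 : ∀ k, μ b - μ k ≤ 1) :
    ∑ k, (μ b - μ k) * pulls 1 (state a x 0) k
      ≤ 22 * lam K 1 * ∑ k with 0 < μ b - μ k, 1 / (μ b - μ k) := by
  have hL := lam_pos hK 1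
  have hp : ∀ k, pulls 1 (state a x 0) k ≤ 2 * lam K 1 := by
    intro k
    have hn : ∀ j, nominalPulls 1 (state a x 0) j = lam K 1 := fun j => by
      simp [nominalPulls, state]
    -- All estimated gaps start at `1`, so the leader gets less than `K λ + 1 - (K - 1) λ = λ + 1`
    -- pulls.
    by_cases hk : IsLeader (state a x 0).est k
    · rw [pulls_of_isLeader hk, Finset.sum_congr rfl fun j _ => hn j, Finset.sum_const,
        Finset.card_erase_of_mem (Finset.mem_univ _), Finset.card_univ, Fintype.card_fin,
        nsmul_eq_mul, Nat.cast_sub (by omega)]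
      have := epochLen_lt hK 0
      have h5 := five_le_confLog hK 1
      have h6 := lam_eq K 1
      push_cast at this ⊢
      simp only [pow_zero, mul_one] at this
      linarith
    · rw [pulls_of_not_isLeader hk, hn]
      linarith
  rw [Finset.mul_sum, Finset.sum_filter]
  refine Finset.sum_le_sum fun k _ => ?_
  split_ifs with hd
  · calc (μ b - μ k) * pulls 1 (state a x 0) k ≤ (μ b - μ k) * (2 * lam K 1) := by
          gcongr; exact hp k
      _ ≤ 1 / (μ b - μ k) * (22 * lam K 1) := by
          have : 1 ≤ 1 / (μ b - μ k) := (one_le_div hd).2 (h1 k)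
          exact mul_le_mul ((h1 k).trans this) (by linarith) (by linarith) (by positivity)
      _ = _ := by ring
  · have : μ b - μ k = 0 := le_antisymm (not_lt.1 hd) (by linarith [hb k])
    rw [this, zero_mul]

end Deterministic

end

/-! ### Measurability along a run and conditional laws -/

noncomputable section

variable {Ω : Type*} {K : ℕ}

theorem measurable_pulls [MeasurableSpace Ω] {s : Ω → EpochState K}
    (he : ∀ k, Measurable fun ω => (s ω).est k) (hg : ∀ k, Measurable fun ω => (s ω).estGap k)
    (m : ℕ) (k : Fin K) : Measurable fun ω => pulls m (s ω) k := by
  have hn : ∀ j, Measurable fun ω => nominalPulls m (s ω) j := fun j =>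
    (((hg j).pow_const 2).inv).const_mul _
  have hset : MeasurableSet {ω | IsLeader (s ω).est k} := by
    have : {ω | IsLeader (s ω).est k} = (⋂ j, {ω | (s ω).est j ≤ (s ω).est k}) ∩
        ⋂ j, ⋂ (_ : j < k), {ω | (s ω).est j < (s ω).est k} := by
      ext ω; simp [IsLeader]
    rw [this]
    exact (MeasurableSet.iInter fun j => measurableSet_le (he j) (he k)).inter
      (MeasurableSet.iInter fun j => MeasurableSet.iInter fun _ =>
        measurableSet_lt (he j) (he k))
  unfold pulls
  exact Measurable.ite hset (measurable_const.sub (Finset.measurable_sum _ fun j _ => hn j)) (hn k)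

/-- Only rounds before the end of epoch `m` are constrained and the σ-algebra is arbitrary, so that
the lemma can be used with the history at that time. -/
theorem measurable_state [MeasurableSpace Ω] {a : ℕ → Ω → Fin K} {x : ℕ → Ω → ℝ} {m : ℕ}
    (ha : ∀ t < epochEnd K m, Measurable (a t)) (hx : ∀ t < epochEnd K m, Measurable (x t)) :
    (∀ k, Measurable fun ω => (state (fun t => a t ω) (fun t => x t ω) m).est k) ∧
    (∀ k, Measurable fun ω => (state (fun t => a t ω) (fun t => x t ω) m).estGap k) := by
  induction m with
  | zero => exact ⟨fun k => measurable_const, fun k => measurable_const⟩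
  | succ m ih =>
    have hlt : ∀ t < epochEnd K m, t < epochEnd K (m + 1) := fun t ht =>
      ht.trans_le (Nat.le_add_right _ _)
    obtain ⟨ihe, ihg⟩ := ih (fun t ht => ha t (hlt t ht)) fun t ht => hx t (hlt t ht)
    have hp := measurable_pulls ihe ihg (m + 1)
    have he : ∀ k, Measurable fun ω =>
        (state (fun t => a t ω) (fun t => x t ω) (m + 1)).est k := fun k => by
      simp only [state_succ_est]
      refine (Measurable.div ?_ (hp k)).min measurable_const
      refine Finset.measurable_sum _ fun t ht => ?_
      have ht := (Finset.mem_Ico.1 ht).2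
      exact Measurable.ite (ha t ht (measurableSet_singleton k)) (hx t ht) measurable_const
    refine ⟨he, fun k => ?_⟩
    simp only [state_succ_estGap]
    refine measurable_const.max (Measurable.sub (Measurable.iSup fun j => (he j).sub ?_) (he k))
    exact (measurable_const.div (hp j)).sqrt

section History

variable (r c : ℕ → Ω → Fin K → ℝ) (I : ℕ → Ω → Fin K)

/-- State of the algorithm after epoch `m` along the run. -/
def runState (m : ℕ) (ω : Ω) : EpochState K :=
  state (fun s => I s ω) (fun s => c s ω (I s ω)) m

/-- Sampling probability of arm `k` in epoch `m + 1` along the run. -/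
def runProb (m : ℕ) (k : Fin K) (ω : Ω) : ℝ := sampleProb (m + 1) (runState c I m ω) k

/-- Indicator of the event that arm `k` is pulled in round `t`. -/
def armInd (t : ℕ) (k : Fin K) : Ω → ℝ := (I t ⁻¹' {k}).indicator fun _ => 1

theorem history_mono {s t : ℕ} (h : s ≤ t) : history r c I s ≤ history r c I t :=
  iSup_mono fun _ => iSup_mono' fun hi => ⟨hi.trans_le h, le_rfl⟩

theorem le_history {s t : ℕ} (h : s < t) : MeasurableSpace.comap (r s) inferInstance ⊔
    MeasurableSpace.comap (c s) inferInstance ⊔ MeasurableSpace.comap (I s) inferInstance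
      ≤ history r c I t :=
  le_iSup₂ (f := fun s (_ : s < t) => MeasurableSpace.comap (r s) inferInstance ⊔
    MeasurableSpace.comap (c s) inferInstance ⊔ MeasurableSpace.comap (I s) inferInstance) s h

theorem measurable_reward_history {s t : ℕ} (h : s < t) : Measurable[history r c I t] (r s) :=
  measurable_iff_comap_le.2 ((le_sup_left.trans le_sup_left).trans (le_history r c I h))

theorem measurable_corrupted_history {s t : ℕ} (h : s < t) : Measurable[history r c I t] (c s) :=
  measurable_iff_comap_le.2 ((le_sup_right.trans le_sup_left).trans (le_history r c I h))

theorem measurable_arm_history {s t : ℕ} (h : s < t) : Measurable[history r c I t] (I s) :=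
  measurable_iff_comap_le.2 (le_sup_right.trans (le_history r c I h))

theorem history_le_beforePull (t : ℕ) : history r c I t ≤ beforePull r c I t :=
  le_sup_left.trans le_sup_left

theorem measurable_reward_beforePull (t : ℕ) : Measurable[beforePull r c I t] (r t) :=
  measurable_iff_comap_le.2 (le_sup_right.trans le_sup_left)

theorem measurable_corrupted_beforePull (t : ℕ) : Measurable[beforePull r c I t] (c t) :=
  measurable_iff_comap_le.2 le_sup_right

variable {r c I}

theorem measurable_eval_arm [MeasurableSpace Ω] {f : Ω → Fin K → ℝ} {i : Ω → Fin K}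
    (hf : Measurable f) (hi : Measurable i) : Measurable fun ω => f ω (i ω) := by
  have : (fun ω => f ω (i ω)) = fun ω => ∑ k, if i ω = k then f ω k else 0 := by
    ext ω; simp
  rw [this]
  exact Finset.measurable_sum _ fun k _ =>
    Measurable.ite (hi (measurableSet_singleton k)) ((measurable_pi_apply k).comp hf)
      measurable_const

theorem measurable_runState_history (m : ℕ) :
    (∀ k, Measurable[history r c I (epochEnd K m)] fun ω => (runState c I m ω).est k) ∧
    (∀ k, Measurable[history r c I (epochEnd K m)] fun ω => (runState c I m ω).estGap k) :=
  @measurable_state Ω K (history r c I (epochEnd K m)) I (fun s ω => c s ω (I s ω)) m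
    (fun _ ht => measurable_arm_history r c I ht)
    fun _ ht => @measurable_eval_arm Ω K (history r c I (epochEnd K m)) _ _
      (measurable_corrupted_history r c I ht) (measurable_arm_history r c I ht)

theorem measurable_runPulls_history (m : ℕ) (k : Fin K) :
    Measurable[history r c I (epochEnd K m)] fun ω => pulls (m + 1) (runState c I m ω) k :=
  @measurable_pulls Ω K (history r c I (epochEnd K m)) _ (measurable_runState_history m).1
    (measurable_runState_history m).2 (m + 1) k

theorem measurable_runProb_history (m : ℕ) (k : Fin K) :
    Measurable[history r c I (epochEnd K m)] (runProb c I m k) :=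
  (measurable_runPulls_history m k).div_const _

theorem measurable_armInd_history {s t : ℕ} (h : s < t) (k : Fin K) :
    Measurable[history r c I t] (armInd I s k) :=
  measurable_const.indicator (measurable_arm_history r c I h (measurableSet_singleton k))

theorem runProb_nonneg (hK : 2 ≤ K) (m : ℕ) (k : Fin K) (ω : Ω) : 0 ≤ runProb c I m k ω :=
  (sampleProb_pos hK (le_state_estGap _ _ m) k).le

theorem runProb_le_one (hK : 2 ≤ K) (m : ℕ) (k : Fin K) (ω : Ω) : runProb c I m k ω ≤ 1 :=
  sampleProb_le_one hK (le_state_estGap _ _ m) k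

theorem armInd_nonneg (t : ℕ) (k : Fin K) (ω : Ω) : 0 ≤ armInd I t k ω :=
  Set.indicator_nonneg (fun _ _ => zero_le_one) ω

theorem armInd_le_one (t : ℕ) (k : Fin K) (ω : Ω) : armInd I t k ω ≤ 1 :=
  Set.indicator_le_self' (fun _ _ => zero_le_one) ω

theorem armInd_eq_ite (t : ℕ) (k : Fin K) (ω : Ω) :
    armInd I t k ω = if I t ω = k then 1 else 0 := by
  by_cases h : I t ω = k <;> simp [armInd, h]

end History

section Run

variable [mΩ : MeasurableSpace Ω] {ν : Measure (Fin K → ℝ)} {P : Measure Ω}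
  {r c : ℕ → Ω → Fin K → ℝ} {I : ℕ → Ω → Fin K}

theorem IsRun.history_le (h : IsRun ν P r c I) (t : ℕ) : history r c I t ≤ mΩ :=
  iSup₂_le fun s _ => sup_le (sup_le (h.measurable_reward s).comap_le
    (h.measurable_corrupted s).comap_le) (h.measurable_arm s).comap_le

theorem IsRun.beforePull_le (h : IsRun ν P r c I) (t : ℕ) : beforePull r c I t ≤ mΩ :=
  sup_le (sup_le (h.history_le t) (h.measurable_reward t).comap_le)
    (h.measurable_corrupted t).comap_le

theorem IsRun.measurable_armInd (h : IsRun ν P r c I) (t : ℕ) (k : Fin K) :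
    Measurable (armInd I t k) :=
  measurable_const.indicator (h.measurable_arm t (measurableSet_singleton k))

theorem IsRun.measurable_runProb (h : IsRun ν P r c I) (m : ℕ) (k : Fin K) :
    Measurable (runProb c I m k) :=
  (measurable_runProb_history (r := r) m k).mono (h.history_le _) le_rfl

theorem IsRun.measurable_runPulls (h : IsRun ν P r c I) (m : ℕ) (k : Fin K) :
    Measurable fun ω => pulls (m + 1) (runState c I m ω) k :=
  (measurable_runPulls_history (r := r) m k).mono (h.history_le _) le_rfl

theorem IsRun.ae_corrupted_mem (h : IsRun ν P r c I) :
    ∀ᵐ ω ∂P, ∀ t k, c t ω k ∈ Set.Icc (0 : ℝ) 1 :=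
  ae_all_iff.2 h.corrupted_mem

theorem IsRun.ae_reward_mem (h : IsRun ν P r c I)
    (hν : ∀ᵐ x ∂ν, ∀ k, x k ∈ Set.Icc (0 : ℝ) 1) :
    ∀ᵐ ω ∂P, ∀ t k, r t ω k ∈ Set.Icc (0 : ℝ) 1 :=
  ae_all_iff.2 fun t => ae_of_ae_map (h.measurable_reward t).aemeasurable
    (by rw [h.reward_law t]; exact hν)

theorem integrable_of_ae_bound [IsProbabilityMeasure P] {f : Ω → ℝ} (hf : Measurable f) {B : ℝ}
    (hB : ∀ᵐ ω ∂P, |f ω| ≤ B) : Integrable f P :=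
  Integrable.of_bound hf.aestronglyMeasurable B hB

/-- Averaging over the arm drawn in round `t` replaces its indicator by its probability. -/
theorem IsRun.integral_mul_armInd [IsProbabilityMeasure P] (h : IsRun ν P r c I) {m t : ℕ}
    (h1 : epochEnd K m ≤ t) (h2 : t < epochEnd K (m + 1)) (k : Fin K) {H : Ω → ℝ}
    (hH : Measurable[beforePull r c I t] H) {B : ℝ} (hB : ∀ᵐ ω ∂P, |H ω| ≤ B) :
    ∫ ω, H ω * armInd I t k ω ∂P = ∫ ω, H ω * runProb c I m k ω ∂P := by
  have hle := h.beforePull_le t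
  have hint : Integrable (armInd I t k) P :=
    integrable_of_ae_bound (h.measurable_armInd t k) (B := 1) (Filter.Eventually.of_forall fun ω => by
      rw [abs_of_nonneg (armInd_nonneg t k ω)]; exact armInd_le_one t k ω)
  have h3 := condExp_stronglyMeasurable_mul_of_bound hle hH.stronglyMeasurable hint B hB
  have h4 : ∫ ω, (H * armInd I t k) ω ∂P = ∫ ω, (P[H * armInd I t k | beforePull r c I t]) ω ∂P :=
    (integral_condExp hle).symm
  refine h4.trans (integral_congr_ae ?_)
  filter_upwards [h3, h.arm_law m t h1 h2 k] with ω e1 e2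
  rw [e1, Pi.mul_apply]
  exact congrArg (H ω * ·) e2

/-- The reward of round `t` is independent of the history. -/
theorem IsRun.integral_mul_reward [IsProbabilityMeasure P] (h : IsRun ν P r c I) (t : ℕ)
    {H : Ω → ℝ} (hH : Measurable[history r c I t] H) {f : (Fin K → ℝ) → ℝ} (hf : Measurable f) :
    ∫ ω, H ω * f (r t ω) ∂P = (∫ ω, H ω ∂P) * ∫ x, f x ∂ν := by
  have hind : IndepFun H (fun ω => f (r t ω)) P := by
    rw [IndepFun_iff_Indep]
    refine indep_of_indep_of_le_left (indep_of_indep_of_le_right (h.reward_indep t).symm ?_)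
      hH.comap_le
    exact (hf.comp (comap_measurable (r t))).comap_le
  rw [hind.integral_fun_mul_eq_mul_integral
    ((hH.mono (h.history_le t) le_rfl).aestronglyMeasurable)
    ((hf.comp (h.measurable_reward t)).aestronglyMeasurable), ← h.reward_law t,
    integral_map (h.measurable_reward t).aemeasurable hf.aestronglyMeasurable]

end Run

end

/-! ### Exponential supermartingales -/

noncomputable section

variable {Ω : Type*} {K : ℕ}

/-- The moment generating function of a centred Bernoulli variable of parameter `p`, scaled by
`x`, is at most `exp (p x²)`. -/
theorem bernoulli_mgf_le {p x y : ℝ} (hp : 0 ≤ p) (hx : |x| ≤ 1) (hy : x ^ 2 ≤ y) :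
    Real.exp (-(p * x) - p * y) * (1 + p * (Real.exp x - 1)) ≤ 1 := by
  have h1 := (abs_le.1 (Real.abs_exp_sub_one_sub_id_le hx)).2
  have h2 : 1 + p * (Real.exp x - 1) ≤ Real.exp (p * (Real.exp x - 1)) := by
    linarith [Real.add_one_le_exp (p * (Real.exp x - 1))]
  calc _ ≤ Real.exp (-(p * x) - p * y) * Real.exp (p * (Real.exp x - 1)) := by gcongr
    _ = Real.exp (p * (Real.exp x - 1 - x - y)) := by rw [← Real.exp_add]; ring_nf
    _ ≤ 1 := by
      rw [Real.exp_le_one_iff]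
      exact mul_nonpos_of_nonneg_of_nonpos hp (by linarith)

/-- Exponential Markov inequality. -/
theorem measureReal_le_exp_neg [MeasurableSpace Ω] {P : Measure Ω} [IsProbabilityMeasure P]
    {X : Ω → ℝ} (hX : Integrable (fun ω => Real.exp (X ω)) P)
    (h1 : ∫ ω, Real.exp (X ω) ∂P ≤ 1) {L : ℝ} {E : Set Ω} (hE : ∀ᵐ ω ∂P, ω ∈ E → L ≤ X ω) :
    P.real E ≤ Real.exp (-L) := by
  have h2 := mul_meas_ge_le_integral_of_nonneg
    (Filter.Eventually.of_forall fun ω => (Real.exp_pos (X ω)).le) hX (Real.exp L)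
  have h3 : P.real E ≤ P.real {ω | Real.exp L ≤ Real.exp (X ω)} := by
    refine ENNReal.toReal_mono (measure_ne_top _ _) (measure_mono_ae ?_)
    filter_upwards [hE] with ω hω hmem using Real.exp_le_exp.2 (hω hmem)
  rw [Real.exp_neg, ← one_div, le_div_iff₀ (Real.exp_pos L)]
  nlinarith [Real.exp_pos L]

section Deviations

variable {ν : Measure (Fin K → ℝ)} {r c : ℕ → Ω → Fin K → ℝ} {I : ℕ → Ω → Fin K}

/-- Deviation, over the first `n` rounds of epoch `m + 1`, of the observed reward of arm `k` from
its conditional expectation given the corrupted rewards. -/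
def armDev (c : ℕ → Ω → Fin K → ℝ) (I : ℕ → Ω → Fin K) (m n : ℕ) (k : Fin K) (ω : Ω) : ℝ :=
  ∑ t ∈ Finset.Ico (epochEnd K m) (epochEnd K m + n),
    (armInd I t k ω - runProb c I m k ω) * c t ω k

/-- Deviation, over the first `n` rounds of epoch `m + 1`, of the reward of arm `k` from its
mean. -/
def rewDev (ν : Measure (Fin K → ℝ)) (r : ℕ → Ω → Fin K → ℝ) (m n : ℕ) (k : Fin K) (ω : Ω) : ℝ :=
  ∑ t ∈ Finset.Ico (epochEnd K m) (epochEnd K m + n), (r t ω k - mean ν k)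

theorem measurable_armDev_history (m n : ℕ) (k : Fin K) :
    Measurable[history r c I (epochEnd K m + n)] (armDev c I m n k) := by
  refine Finset.measurable_sum _ fun t ht => ?_
  have ht := (Finset.mem_Ico.1 ht).2
  refine Measurable.mul ((measurable_armInd_history ht k).sub
    ((measurable_runProb_history m k).mono (history_mono r c I (Nat.le_add_right _ _)) le_rfl)) ?_
  exact (measurable_pi_apply k).comp (measurable_corrupted_history r c I ht)

theorem measurable_rewDev_history (m n : ℕ) (k : Fin K) :
    Measurable[history r c I (epochEnd K m + n)] (rewDev ν r m n k) := by
  refine Finset.measurable_sum _ fun t ht => Measurable.sub ?_ measurable_const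
  exact (measurable_pi_apply k).comp (measurable_reward_history r c I (Finset.mem_Ico.1 ht).2)

theorem mean_nonneg (hν : ∀ᵐ x ∂ν, ∀ k, x k ∈ Set.Icc (0 : ℝ) 1) (k : Fin K) : 0 ≤ mean ν k :=
  integral_nonneg_of_ae (by filter_upwards [hν] with x hx using (hx k).1)

theorem integrable_eval [IsProbabilityMeasure ν] (hν : ∀ᵐ x ∂ν, ∀ k, x k ∈ Set.Icc (0 : ℝ) 1)
    (k : Fin K) : Integrable (fun x : Fin K → ℝ => x k) ν := by
  refine integrable_of_ae_bound (B := 1) (measurable_pi_apply k) ?_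
  filter_upwards [hν] with x hx
  rw [abs_of_nonneg (hx k).1]
  exact (hx k).2

theorem mean_le_one [IsProbabilityMeasure ν] (hν : ∀ᵐ x ∂ν, ∀ k, x k ∈ Set.Icc (0 : ℝ) 1)
    (k : Fin K) : mean ν k ≤ 1 := by
  have : ∫ x, x k ∂ν ≤ ∫ _, (1 : ℝ) ∂ν :=
    integral_mono_ae (integrable_eval hν k) (integrable_const 1)
      (by filter_upwards [hν] with x hx using (hx k).2)
  simpa [mean] using this

/-- Exponent of the supermartingale that controls `armDev`. -/
def armExponent (c : ℕ → Ω → Fin K → ℝ) (I : ℕ → Ω → Fin K) (m n : ℕ) (k : Fin K) (η : Ω → ℝ)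
    (ω : Ω) : ℝ :=
  η ω * armDev c I m n k ω - n * (runProb c I m k ω * η ω ^ 2)

theorem measurable_armExponent_history (m n : ℕ) (k : Fin K) {η : Ω → ℝ}
    (hη : Measurable[history r c I (epochEnd K m)] η) :
    Measurable[history r c I (epochEnd K m + n)] (armExponent c I m n k η) := by
  have hle := history_mono r c I (Nat.le_add_right (epochEnd K m) n)
  have hη' := hη.mono hle le_rfl
  exact (hη'.mul (measurable_armDev_history m n k)).sub
    ((((measurable_runProb_history m k).mono hle le_rfl).mul (hη'.pow_const 2)).const_mul _)

end Deviations

section Run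

variable [mΩ : MeasurableSpace Ω] {ν : Measure (Fin K → ℝ)} {P : Measure Ω}
  {r c : ℕ → Ω → Fin K → ℝ} {I : ℕ → Ω → Fin K}

theorem IsRun.ae_abs_armDev_le (hK : 2 ≤ K) (h : IsRun ν P r c I) (m n : ℕ) (k : Fin K) :
    ∀ᵐ ω ∂P, |armDev c I m n k ω| ≤ n := by
  filter_upwards [h.ae_corrupted_mem] with ω hω
  refine (Finset.abs_sum_le_sum_abs _ _).trans ?_
  refine (Finset.sum_le_card_nsmul _ _ 1 fun t _ => ?_).trans (by simp)
  have h1 : |armInd I t k ω - runProb c I m k ω| ≤ 1 := by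
    rw [abs_le]
    constructor <;> linarith [armInd_nonneg (I := I) t k ω, armInd_le_one (I := I) t k ω,
      runProb_nonneg (c := c) (I := I) hK m k ω, runProb_le_one (c := c) (I := I) hK m k ω]
  have h2 : |c t ω k| ≤ 1 := by
    rw [abs_of_nonneg (hω t k).1]; exact (hω t k).2
  rw [abs_mul]
  exact mul_le_one₀ h1 (abs_nonneg _) h2

theorem IsRun.ae_armExponent_le (hK : 2 ≤ K) (h : IsRun ν P r c I) (m n : ℕ) (k : Fin K)
    {η : Ω → ℝ} (hη : ∀ᵐ ω ∂P, |η ω| ≤ 1) : ∀ᵐ ω ∂P, armExponent c I m n k η ω ≤ n := by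
  filter_upwards [hη, h.ae_abs_armDev_le hK m n k] with ω h1 h2
  have h3 : η ω * armDev c I m n k ω ≤ n := by
    refine (le_abs_self _).trans ?_
    rw [abs_mul]
    calc _ ≤ 1 * (n : ℝ) := by gcongr
      _ = n := one_mul _
  have h4 := runProb_nonneg (c := c) (I := I) hK m k ω
  have h5 : 0 ≤ n * (runProb c I m k ω * η ω ^ 2) := by positivity
  unfold armExponent
  linarith

theorem IsRun.integrable_exp_armExponent [IsProbabilityMeasure P] (hK : 2 ≤ K)
    (h : IsRun ν P r c I) (m n : ℕ) (k : Fin K) {η : Ω → ℝ}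
    (hηm : Measurable[history r c I (epochEnd K m)] η) (hη : ∀ᵐ ω ∂P, |η ω| ≤ 1) :
    Integrable (fun ω => Real.exp (armExponent c I m n k η ω)) P := by
  refine integrable_of_ae_bound (B := Real.exp n)
    (((measurable_armExponent_history m n k hηm).mono (h.history_le _) le_rfl).exp) ?_
  filter_upwards [h.ae_armExponent_le hK m n k hη] with ω hω
  rw [abs_of_pos (Real.exp_pos _)]
  exact Real.exp_le_exp.2 hω

/-- Induction over rounds: given the corrupted reward of the round, only the draw of the arm is
random, and `bernoulli_mgf_le` bounds the conditional expectation of the new factor by `1`. -/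
theorem IsRun.integral_exp_armExponent_le [IsProbabilityMeasure P] (hK : 2 ≤ K)
    (h : IsRun ν P r c I) (m : ℕ) (k : Fin K) {η : Ω → ℝ}
    (hηm : Measurable[history r c I (epochEnd K m)] η) (hη : ∀ᵐ ω ∂P, |η ω| ≤ 1) {n : ℕ}
    (hn : n ≤ epochLen K (m + 1)) :
    ∫ ω, Real.exp (armExponent c I m n k η ω) ∂P ≤ 1 := by
  induction n with
  | zero => simp [armExponent, armDev]
  | succ n ih =>
    refine le_trans ?_ (ih (by omega))
    set t := epochEnd K m + n with ht
    have ht2 : t < epochEnd K (m + 1) := by rw [epochEnd]; omega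
    set p := runProb c I m k with hp
    have hle : history r c I (epochEnd K m) ≤ beforePull r c I t :=
      (history_mono r c I (Nat.le_add_right _ _)).trans (history_le_beforePull r c I t)
    have hpm : Measurable[beforePull r c I t] p := (measurable_runProb_history m k).mono hle le_rfl
    have hηm' : Measurable[beforePull r c I t] η := hηm.mono hle le_rfl
    have hcm : Measurable[beforePull r c I t] fun ω => c t ω k :=
      (measurable_pi_apply k).comp (measurable_corrupted_beforePull r c I t)
    have hZm : Measurable[beforePull r c I t] (armExponent c I m n k η) :=
      (measurable_armExponent_history m n k hηm).mono (history_le_beforePull r c I t) le_rfl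
    let H₁ : Ω → ℝ := fun ω => Real.exp (armExponent c I m n k η ω)
      * Real.exp (-(p ω * (η ω * c t ω k)) - p ω * η ω ^ 2)
    let H₂ : Ω → ℝ := fun ω => H₁ ω * (Real.exp (η ω * c t ω k) - 1)
    have hH₁ : Measurable[beforePull r c I t] H₁ :=
      hZm.exp.mul (((hpm.mul (hηm'.mul hcm)).neg.sub (hpm.mul (hηm'.pow_const 2))).exp)
    have hH₂ : Measurable[beforePull r c I t] H₂ :=
      hH₁.mul ((hηm'.mul hcm).exp.sub measurable_const)
    have hx : ∀ᵐ ω ∂P, |η ω * c t ω k| ≤ 1 ∧ (η ω * c t ω k) ^ 2 ≤ η ω ^ 2 := by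
      filter_upwards [hη, h.ae_corrupted_mem] with ω h1 h2
      have h3 := (h2 t k).1
      have h4 := (h2 t k).2
      refine ⟨?_, ?_⟩
      · rw [abs_mul, abs_of_nonneg h3]
        exact mul_le_one₀ h1 h3 h4
      · rw [mul_pow]
        exact mul_le_of_le_one_right (sq_nonneg _) (pow_le_one₀ h3 h4)
    have hb₁ : ∀ᵐ ω ∂P, |H₁ ω| ≤ Real.exp n * Real.exp 1 := by
      filter_upwards [hx, h.ae_armExponent_le hK m n k hη] with ω h1 h2
      rw [abs_of_pos (by positivity)]
      refine mul_le_mul (Real.exp_le_exp.2 h2) (Real.exp_le_exp.2 ?_) (by positivity)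
        (by positivity)
      have h3 : 0 ≤ p ω := runProb_nonneg hK m k ω
      have h4 : p ω ≤ 1 := runProb_le_one hK m k ω
      have h5 := (abs_le.1 h1.1).1
      nlinarith [mul_nonneg h3 (sq_nonneg (η ω))]
    have hb₂ : ∀ᵐ ω ∂P, |H₂ ω| ≤ Real.exp n * Real.exp 1 * 2 := by
      filter_upwards [hx, hb₁] with ω h1 h2
      rw [abs_mul]
      have h3 := Real.abs_exp_sub_one_le h1.1
      exact mul_le_mul h2 (by linarith [h1.1]) (abs_nonneg _) (by positivity)
    have hi₁ := integrable_of_ae_bound (hH₁.mono (h.beforePull_le t) le_rfl) hb₁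
    have hi₂ := integrable_of_ae_bound (hH₂.mono (h.beforePull_le t) le_rfl) hb₂
    have hi₂I : Integrable (fun ω => H₂ ω * armInd I t k ω) P := by
      refine hi₂.mul_bdd (c := 1) (h.measurable_armInd t k).aestronglyMeasurable
        (Filter.Eventually.of_forall fun ω => ?_)
      rw [Real.norm_of_nonneg (armInd_nonneg t k ω)]
      exact armInd_le_one t k ω
    have hi₂p : Integrable (fun ω => H₂ ω * p ω) P := by
      refine hi₂.mul_bdd (c := 1) (h.measurable_runProb m k).aestronglyMeasurable
        (Filter.Eventually.of_forall fun ω => ?_)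
      rw [Real.norm_of_nonneg (runProb_nonneg hK m k ω)]
      exact runProb_le_one hK m k ω
    have e1 : ∀ ω, Real.exp (armExponent c I m (n + 1) k η ω) = H₁ ω + H₂ ω * armInd I t k ω := by
      intro ω
      have e2 : armExponent c I m (n + 1) k η ω = armExponent c I m n k η ω
          + (-(p ω * (η ω * c t ω k)) - p ω * η ω ^ 2) + armInd I t k ω * (η ω * c t ω k) := by
        unfold armExponent armDev
        rw [← add_assoc, Finset.sum_Ico_succ_top (Nat.le_add_right _ _), ← ht, ← hp]
        push_cast
        ring
      -- The indicator takes the values `0` and `1`, so its exponential is affine in it and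
      -- `integral_mul_armInd` applies.
      have e3 : Real.exp (armInd I t k ω * (η ω * c t ω k))
          = 1 + (Real.exp (η ω * c t ω k) - 1) * armInd I t k ω := by
        rw [armInd_eq_ite]; split_ifs <;> simp
      rw [e2, Real.exp_add, Real.exp_add, e3]
      simp only [H₂, H₁]
      ring
    calc ∫ ω, Real.exp (armExponent c I m (n + 1) k η ω) ∂P
        = ∫ ω, (H₁ ω + H₂ ω * armInd I t k ω) ∂P := by simp_rw [e1]
      _ = ∫ ω, H₁ ω ∂P + ∫ ω, H₂ ω * armInd I t k ω ∂P := integral_add hi₁ hi₂I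
      _ = ∫ ω, H₁ ω ∂P + ∫ ω, H₂ ω * p ω ∂P := by
        rw [h.integral_mul_armInd (Nat.le_add_right _ _) ht2 k hH₂ hb₂]
      _ = ∫ ω, (H₁ ω + H₂ ω * p ω) ∂P := (integral_add hi₁ hi₂p).symm
      _ ≤ ∫ ω, Real.exp (armExponent c I m n k η ω) ∂P := by
        refine integral_mono_ae (hi₁.add hi₂p) (h.integrable_exp_armExponent hK m n k hηm hη) ?_
        filter_upwards [hx] with ω h1
        have h2 := bernoulli_mgf_le (runProb_nonneg (c := c) (I := I) hK m k ω) h1.1 h1.2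
        rw [← hp] at h2
        calc H₁ ω + H₂ ω * p ω = Real.exp (armExponent c I m n k η ω) *
              (Real.exp (-(p ω * (η ω * c t ω k)) - p ω * η ω ^ 2)
                * (1 + p ω * (Real.exp (η ω * c t ω k) - 1))) := by simp only [H₂, H₁]; ring
          _ ≤ _ := mul_le_of_le_one_right (Real.exp_pos _).le h2

theorem IsRun.ae_abs_rewDev_le [IsProbabilityMeasure ν] (h : IsRun ν P r c I)
    (hν : ∀ᵐ x ∂ν, ∀ k, x k ∈ Set.Icc (0 : ℝ) 1) (m n : ℕ) (k : Fin K) :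
    ∀ᵐ ω ∂P, |rewDev ν r m n k ω| ≤ n := by
  have hm0 := mean_nonneg hν k
  have hm1 := mean_le_one hν k
  filter_upwards [h.ae_reward_mem hν] with ω hω
  refine (Finset.abs_sum_le_sum_abs _ _).trans ?_
  refine (Finset.sum_le_card_nsmul _ _ 1 fun t _ => ?_).trans (by simp)
  have := hω t k
  rw [abs_le]
  constructor <;> linarith [this.1, this.2]

theorem integral_exp_reward_le [IsProbabilityMeasure ν]
    (hν : ∀ᵐ x ∂ν, ∀ k, x k ∈ Set.Icc (0 : ℝ) 1) (k : Fin K) (θ : ℝ) :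
    ∫ x, Real.exp (θ * (x k - mean ν k) - θ ^ 2 / 8) ∂ν ≤ 1 := by
  have h1 := (hasSubgaussianMGF_of_mem_Icc (μ := ν) (X := fun x : Fin K → ℝ => x k)
    (measurable_pi_apply k).aemeasurable
    (by filter_upwards [hν] with x hx using hx k)).mgf_le θ
  rw [mgf] at h1
  -- Hoeffding's lemma on an interval of length `1`: variance proxy `1/4`.
  have e : (((‖(1 : ℝ) - 0‖₊ / 2) ^ 2 : NNReal) : ℝ) * θ ^ 2 / 2 = θ ^ 2 / 8 := by
    simp; ring
  rw [e] at h1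
  simp_rw [Real.exp_sub]
  rw [integral_div]
  exact (div_le_one (Real.exp_pos _)).2 h1

theorem IsRun.integrable_exp_rewDev [IsProbabilityMeasure P] [IsProbabilityMeasure ν]
    (h : IsRun ν P r c I) (hν : ∀ᵐ x ∂ν, ∀ k, x k ∈ Set.Icc (0 : ℝ) 1) (m n : ℕ) (k : Fin K)
    (θ : ℝ) : Integrable (fun ω => Real.exp (θ * rewDev ν r m n k ω - n * (θ ^ 2 / 8))) P := by
  refine integrable_of_ae_bound (B := Real.exp (|θ| * n)) ?_ ?_
  · exact ((((measurable_rewDev_history (c := c) (I := I) m n k).mono (h.history_le _)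
      le_rfl).const_mul θ).sub measurable_const).exp
  · filter_upwards [h.ae_abs_rewDev_le hν m n k] with ω hω
    rw [abs_of_pos (Real.exp_pos _), Real.exp_le_exp]
    have h1 : θ * rewDev ν r m n k ω ≤ |θ| * n := by
      refine (le_abs_self _).trans ?_
      rw [abs_mul]
      gcongr
    have h2 : 0 ≤ n * (θ ^ 2 / 8) := by positivity
    linarith

/-- The true reward of each round is independent of the history, adversary included, so each round
contributes a factor at most `1`. -/
theorem IsRun.integral_exp_rewDev_le [IsProbabilityMeasure P] [IsProbabilityMeasure ν]
    (h : IsRun ν P r c I) (hν : ∀ᵐ x ∂ν, ∀ k, x k ∈ Set.Icc (0 : ℝ) 1) (m n : ℕ) (k : Fin K)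
    (θ : ℝ) : ∫ ω, Real.exp (θ * rewDev ν r m n k ω - n * (θ ^ 2 / 8)) ∂P ≤ 1 := by
  induction n with
  | zero => simp [rewDev]
  | succ n ih =>
    have e : ∀ ω, Real.exp (θ * rewDev ν r m (n + 1) k ω - (n + 1 : ℕ) * (θ ^ 2 / 8))
        = Real.exp (θ * rewDev ν r m n k ω - n * (θ ^ 2 / 8))
          * (fun x : Fin K → ℝ => Real.exp (θ * (x k - mean ν k) - θ ^ 2 / 8))
            (r (epochEnd K m + n) ω) := by
      intro ω
      simp only [rewDev]
      rw [← Real.exp_add, ← add_assoc, Finset.sum_Ico_succ_top (Nat.le_add_right _ _)]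
      congr 1
      push_cast
      ring
    have hH : Measurable[history r c I (epochEnd K m + n)] fun ω =>
        Real.exp (θ * rewDev ν r m n k ω - n * (θ ^ 2 / 8)) :=
      (((measurable_rewDev_history m n k).const_mul θ).sub measurable_const).exp
    rw [integral_congr_ae (Filter.Eventually.of_forall e),
      h.integral_mul_reward (epochEnd K m + n) hH
        (f := fun x => Real.exp (θ * (x k - mean ν k) - θ ^ 2 / 8)) (by fun_prop)]
    exact mul_le_one₀ ih (integral_nonneg fun x => (Real.exp_pos _).le)
      (integral_exp_reward_le hν k θ)

end Run

end

/-! ### Failure events and accuracy of the estimates -/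

noncomputable section

variable {Ω : Type*} {K : ℕ}

theorem sqrt_div_mul_sqrt_mul {L n : ℝ} (hL : 0 ≤ L) (hn : 0 < n) :
    Real.sqrt (L / n) * Real.sqrt (L * n) = L := by
  rw [← Real.sqrt_mul (by positivity), show L / n * (L * n) = L ^ 2 by field_simp,
    Real.sqrt_sq hL]

section Failure

variable (ν : Measure (Fin K → ℝ)) (r c : ℕ → Ω → Fin K → ℝ) (I : ℕ → Ω → Fin K)

/-- The event that the sampling of epoch `m + 1` deviates too much from its mean. -/
def failSet (m : ℕ) : Set Ω :=
  ⋃ k, ({ω | 2 * Real.sqrt (confLog K (m + 1) * pulls (m + 1) (runState c I m ω) k)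
      < |armDev c I m (epochLen K (m + 1)) k ω|} ∪
    {ω | Real.sqrt (confLog K (m + 1) * epochLen K (m + 1))
      < |rewDev ν r m (epochLen K (m + 1)) k ω|})

/-- Realized corruption in epoch `m + 1`. -/
def epochCorruption (m : ℕ) (ω : Ω) : ℝ :=
  ∑ t ∈ Finset.Ico (epochEnd K m) (epochEnd K (m + 1)), ⨆ k, |c t ω k - r t ω k|

/-- Error level of epoch `m + 1`: average corruption, or `1` if the sampling deviates too much. -/
def errLevel (m : ℕ) (ω : Ω) : ℝ :=
  epochCorruption r c m ω / epochLen K (m + 1) + (failSet ν r c I m).indicator (fun _ => 1) ω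

variable {ν r c I}

theorem epochCorruption_nonneg (m : ℕ) (ω : Ω) : 0 ≤ epochCorruption r c m ω :=
  Finset.sum_nonneg fun _ _ => Real.iSup_nonneg fun _ => abs_nonneg _

theorem errLevel_nonneg (m : ℕ) (ω : Ω) : 0 ≤ errLevel ν r c I m ω :=
  add_nonneg (div_nonneg (epochCorruption_nonneg m ω) (Nat.cast_nonneg _))
    (Set.indicator_nonneg (fun _ _ => zero_le_one) ω)

/-- After division by `ñ_k = p N`, the second term is the plain average of the corrupted rewards
over the epoch. Corruption therefore enters only through its average, even for rarely pulled arms.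
-/
theorem epochTotal_eq (m : ℕ) (k : Fin K) (ω : Ω) :
    epochTotal (fun s => I s ω) (fun s => c s ω (I s ω)) m k
      = armDev c I m (epochLen K (m + 1)) k ω + runProb c I m k ω
        * ∑ t ∈ Finset.Ico (epochEnd K m) (epochEnd K (m + 1)), c t ω k := by
  unfold epochTotal armDev
  rw [Finset.mul_sum, ← epochEnd, ← Finset.sum_add_distrib]
  refine Finset.sum_congr rfl fun t _ => ?_
  rw [armInd_eq_ite]
  split_ifs with h
  · change c t ω (I t ω) = _
    rw [show I t ω = k from h]
    ring
  · ring

theorem abs_sum_sub_le (m : ℕ) (k : Fin K) (ω : Ω) :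
    |∑ t ∈ Finset.Ico (epochEnd K m) (epochEnd K (m + 1)), c t ω k
      - ∑ t ∈ Finset.Ico (epochEnd K m) (epochEnd K (m + 1)), r t ω k|
      ≤ epochCorruption r c m ω := by
  rw [← Finset.sum_sub_distrib]
  refine (Finset.abs_sum_le_sum_abs _ _).trans (Finset.sum_le_sum fun t _ => ?_)
  exact le_ciSup (f := fun k => |c t ω k - r t ω k|) (Set.finite_range _).bddAbove k

theorem rewDev_epochLen (m : ℕ) (k : Fin K) (ω : Ω) : rewDev ν r m (epochLen K (m + 1)) k ω
    = ∑ t ∈ Finset.Ico (epochEnd K m) (epochEnd K (m + 1)), r t ω k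
      - epochLen K (m + 1) * mean ν k := by
  unfold rewDev
  rw [Finset.sum_sub_distrib, Finset.sum_const, Nat.card_Ico, Nat.add_sub_cancel_left,
    nsmul_eq_mul, ← epochEnd]

/-- From `K ≥ 2`, `N ≥ 512 L 4^m` for the confidence logarithm `L`, and `1/512 = 8/4096 < 9/4096`.
-/
theorem sqrt_confLog_div_le (hK : 2 ≤ K) (m : ℕ) :
    Real.sqrt (confLog K (m + 1) / epochLen K (m + 1)) ≤ 3 / 32 * (2 ^ (m + 1))⁻¹ := by
  have hN := epochLen_pos hK m
  have hL := five_le_confLog hK (m + 1)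
  have h1 := le_epochLen K m
  have h2 : (2 : ℝ) ≤ K := by exact_mod_cast hK
  rw [Real.sqrt_le_left (by positivity), div_le_iff₀ hN]
  have h4 : ((3 / 32 * ((2 : ℝ) ^ (m + 1))⁻¹) ^ 2) = 9 / 4096 * ((4 : ℝ) ^ m)⁻¹ := by
    rw [← two_pow_two_mul, mul_comm 2 m, pow_mul, pow_succ (2 : ℝ) m]
    field_simp
    norm_num
  rw [h4]
  have h5 : 2 * (256 * confLog K (m + 1)) * (4 : ℝ) ^ m ≤ epochLen K (m + 1) := by
    refine le_trans ?_ h1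
    rw [lam_eq]
    gcongr
  have h6 := mul_le_mul_of_nonneg_left h5 (by positivity : (0 : ℝ) ≤ 9 / 4096 * ((4 : ℝ) ^ m)⁻¹)
  have h7 : 9 / 4096 * ((4 : ℝ) ^ m)⁻¹ * (2 * (256 * confLog K (m + 1)) * (4 : ℝ) ^ m)
      = 9 / 8 * confLog K (m + 1) := by
    field_simp
    norm_num
  linarith

/-- Truncating an estimate at an upper bound of its target does not increase the error. -/
theorem abs_min_sub_le {y μ e : ℝ} (hμ : μ ≤ 1) (h : |y - μ| ≤ e) : |min y 1 - μ| ≤ e := by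
  have h' := abs_le.1 h
  rcases le_total y 1 with h1 | h1
  · rwa [min_eq_left h1]
  · rw [min_eq_right h1, abs_le]
    constructor <;> linarith [h'.1, h'.2]

theorem accurate_of_bounds (hK : 2 ≤ K) (hμ0 : ∀ k, 0 ≤ mean ν k) (hμ1 : ∀ k, mean ν k ≤ 1)
    {ω : Ω} (hc : ∀ t k, 0 ≤ c t ω k) (m : ℕ) :
    Accurate (fun s => I s ω) (fun s => c s ω (I s ω)) (mean ν)
      (fun i => errLevel ν r c I i ω) m := by
  intro k
  have hN := epochLen_pos hK m
  have hL := five_le_confLog hK (m + 1)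
  have hn : 0 < pulls (m + 1) (runState c I m ω) k := pulls_pos hK (le_state_estGap _ _ m) k
  have hw : 0 ≤ width (fun s => I s ω) (fun s => c s ω (I s ω)) m k := Real.sqrt_nonneg _
  have hC : 0 ≤ epochCorruption r c m ω / epochLen K (m + 1) :=
    div_nonneg (epochCorruption_nonneg m ω) hN.le
  have hu : (0 : ℝ) < (2 ^ (m + 1))⁻¹ := by positivity
  -- On the failure event the error level is at least `1`, and both the estimate and the mean lie in
  -- `[0, 1]`.
  by_cases hf : ω ∈ failSet ν r c I m
  · have h1 : errLevel ν r c I m ω = epochCorruption r c m ω / epochLen K (m + 1) + 1 := by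
      simp [errLevel, hf]
    have h2 := state_est_nonneg (fun s => I s ω) (fun s => c s ω (I s ω)) hK
      (fun t => hc t _) (m + 1) k
    have h3 := state_est_le_one (fun s => I s ω) (fun s => c s ω (I s ω)) (m + 1) k
    have h4 : |(state (fun s => I s ω) (fun s => c s ω (I s ω)) (m + 1)).est k - mean ν k| ≤ 1 := by
      rw [abs_le]
      constructor <;> linarith [hμ0 k, hμ1 k]
    linarith
  · have h1 : errLevel ν r c I m ω = epochCorruption r c m ω / epochLen K (m + 1) := by
      simp [errLevel, hf]
    simp only [failSet, Set.mem_iUnion, Set.mem_union, Set.mem_ofPred_eq, not_exists, not_or,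
      not_lt] at hf
    obtain ⟨hA, hR⟩ := hf k
    rw [state_succ_est]
    refine abs_min_sub_le (hμ1 k) ?_
    simp only [h1]
    set n := pulls (m + 1) (runState c I m ω) k with hn_def
    set N : ℝ := (epochLen K (m + 1) : ℝ) with hN_def
    set L := confLog K (m + 1) with hL_def
    have hpN : runProb c I m k ω = n / N := rfl
    have hw' : width (fun s => I s ω) (fun s => c s ω (I s ω)) m k = 2 * Real.sqrt (L / n) := by
      unfold width
      change Real.sqrt (4 * L / n) = _
      rw [mul_div_assoc, Real.sqrt_mul (by norm_num), show (4 : ℝ) = 2 ^ 2 by norm_num,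
        Real.sqrt_sq (by norm_num)]
    have hdecomp : epochTotal (fun s => I s ω) (fun s => c s ω (I s ω)) m k / n - mean ν k
        = (∑ t ∈ Finset.Ico (epochEnd K m) (epochEnd K (m + 1)), c t ω k
            - ∑ t ∈ Finset.Ico (epochEnd K m) (epochEnd K (m + 1)), r t ω k) / N
          + rewDev ν r m (epochLen K (m + 1)) k ω / N
          + armDev c I m (epochLen K (m + 1)) k ω / n := by
      rw [epochTotal_eq, rewDev_epochLen, hpN, ← hN_def]
      field_simp
      ring
    have b1 : |(∑ t ∈ Finset.Ico (epochEnd K m) (epochEnd K (m + 1)), c t ω k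
        - ∑ t ∈ Finset.Ico (epochEnd K m) (epochEnd K (m + 1)), r t ω k) / N|
        ≤ epochCorruption r c m ω / N := by
      rw [abs_div, abs_of_pos hN]
      gcongr
      exact abs_sum_sub_le m k ω
    have sq : ∀ y : ℝ, 0 < y → Real.sqrt (L * y) / y = Real.sqrt (L / y) := fun y hy => by
      rw [Real.sqrt_mul (by linarith), Real.sqrt_div (by linarith), mul_div_assoc,
        Real.sqrt_div_self, ← div_eq_mul_inv]
    have b2 : |rewDev ν r m (epochLen K (m + 1)) k ω / N| ≤ 3 / 32 * (2 ^ (m + 1))⁻¹ := by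
      rw [abs_div, abs_of_pos hN]
      refine le_trans ?_ (sqrt_confLog_div_le hK m)
      rw [← hL_def, ← hN_def, ← sq N hN]
      gcongr
    have b3 : |armDev c I m (epochLen K (m + 1)) k ω / n|
        ≤ width (fun s => I s ω) (fun s => c s ω (I s ω)) m k := by
      rw [abs_div, abs_of_pos hn, hw', ← sq n hn, ← mul_div_assoc]
      gcongr
    change |epochTotal (fun s => I s ω) (fun s => c s ω (I s ω)) m k / n - mean ν k| ≤ _
    rw [hdecomp]
    refine (abs_add_le _ _).trans (add_le_add ((abs_add_le _ _).trans (add_le_add b1 b2)) b3)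

end Failure

section Run

variable [mΩ : MeasurableSpace Ω] {ν : Measure (Fin K → ℝ)} {P : Measure Ω}
  {r c : ℕ → Ω → Fin K → ℝ} {I : ℕ → Ω → Fin K}

/-- With `η = σ √(L/ñ)` a deviation beyond `2√(L ñ)` contributes at least `2L` to the exponent, and
the compensator `N p η² = ñ η²` removes exactly `L`. The constraint `|η| ≤ 1` holds because `ñ ≥ λ =
256 L`. -/
theorem IsRun.measureReal_armDev_gt_le [IsProbabilityMeasure P] (hK : 2 ≤ K)
    (h : IsRun ν P r c I) (m : ℕ) (k : Fin K) {σ : ℝ} (hσ : σ ^ 2 = 1) :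
    P.real {ω | 2 * Real.sqrt (confLog K (m + 1) * pulls (m + 1) (runState c I m ω) k)
      < σ * armDev c I m (epochLen K (m + 1)) k ω} ≤ Real.exp (-confLog K (m + 1)) := by
  have hL := five_le_confLog hK (m + 1)
  have hσ' : |σ| = 1 := by
    rw [← sq_eq_sq₀ (abs_nonneg _) zero_le_one, sq_abs, hσ, one_pow]
  let η : Ω → ℝ := fun ω =>
    σ * Real.sqrt (confLog K (m + 1) / pulls (m + 1) (runState c I m ω) k)
  have hηm : Measurable[history r c I (epochEnd K m)] η :=
    ((measurable_const.div (measurable_runPulls_history m k)).sqrt).const_mul σ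
  have hη : ∀ᵐ ω ∂P, |η ω| ≤ 1 := by
    filter_upwards [h.ae_corrupted_mem] with ω hω
    have h1 : lam K (m + 1) ≤ pulls (m + 1) (runState c I m ω) k :=
      (le_nominalPulls hK _ (state_estGap_pos _ _ m k)
        (state_estGap_le_one _ _ hK (fun t => (hω t _).1) m k)).trans
        (nominalPulls_le_pulls hK (le_state_estGap _ _ m) k)
    have h2 := lam_pos hK (m + 1)
    rw [abs_mul, hσ', one_mul, abs_of_nonneg (Real.sqrt_nonneg _), Real.sqrt_le_one,
      div_le_one (by linarith)]
    rw [lam_eq] at h1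
    linarith
  refine measureReal_le_exp_neg (h.integrable_exp_armExponent hK m _ k hηm hη)
    (h.integral_exp_armExponent_le hK m k hηm hη le_rfl) (Filter.Eventually.of_forall fun ω hω => ?_)
  have hn : 0 < pulls (m + 1) (runState c I m ω) k := pulls_pos hK (le_state_estGap _ _ m) k
  have hlt : 2 * Real.sqrt (confLog K (m + 1) * pulls (m + 1) (runState c I m ω) k)
      < σ * armDev c I m (epochLen K (m + 1)) k ω := hω
  have h1 := mul_le_mul_of_nonneg_left hlt.le
    (Real.sqrt_nonneg (confLog K (m + 1) / pulls (m + 1) (runState c I m ω) k))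
  have h2 := sqrt_div_mul_sqrt_mul (by linarith : 0 ≤ confLog K (m + 1)) hn
  have h3 : epochLen K (m + 1) * (runProb c I m k ω * η ω ^ 2) = confLog K (m + 1) := by
    simp only [η]
    rw [mul_pow, hσ, one_mul, Real.sq_sqrt (by positivity), ← mul_assoc,
      mul_comm _ (runProb c I m k ω), runProb, sampleProb_mul_epochLen hK]
    field_simp
  unfold armExponent
  rw [h3]
  simp only [η]
  linarith

/-- With `θ = 2σ √(L/N)` the exponent is at least `2L - L/2`, more than the `L` that is needed. -/
theorem IsRun.measureReal_rewDev_gt_le [IsProbabilityMeasure P] [IsProbabilityMeasure ν]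
    (hK : 2 ≤ K) (h : IsRun ν P r c I) (hν : ∀ᵐ x ∂ν, ∀ k, x k ∈ Set.Icc (0 : ℝ) 1)
    (m : ℕ) (k : Fin K) {σ : ℝ} (hσ : σ ^ 2 = 1) :
    P.real {ω | Real.sqrt (confLog K (m + 1) * epochLen K (m + 1))
      < σ * rewDev ν r m (epochLen K (m + 1)) k ω} ≤ Real.exp (-confLog K (m + 1)) := by
  have hL := five_le_confLog hK (m + 1)
  have hN := epochLen_pos hK m
  let θ : ℝ := σ * (2 * Real.sqrt (confLog K (m + 1) / epochLen K (m + 1)))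
  refine measureReal_le_exp_neg (h.integrable_exp_rewDev hν m (epochLen K (m + 1)) k θ)
    (h.integral_exp_rewDev_le hν m (epochLen K (m + 1)) k θ) (Filter.Eventually.of_forall fun ω hω => ?_)
  have hlt : Real.sqrt (confLog K (m + 1) * epochLen K (m + 1))
      < σ * rewDev ν r m (epochLen K (m + 1)) k ω := hω
  have h1 := mul_le_mul_of_nonneg_left hlt.le
    (Real.sqrt_nonneg (confLog K (m + 1) / epochLen K (m + 1)))
  have h2 := sqrt_div_mul_sqrt_mul (by linarith : 0 ≤ confLog K (m + 1)) hN
  have h3 : epochLen K (m + 1) * (θ ^ 2 / 8) = confLog K (m + 1) / 2 := by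
    simp only [θ]
    rw [mul_pow, hσ, one_mul, mul_pow, Real.sq_sqrt (by positivity)]
    field_simp
    norm_num
  rw [h3]
  simp only [θ]
  linarith

/-- Two deviations with two signs for each of `K` arms: `4 K exp(-L) = K β = δ`. -/
theorem IsRun.measureReal_failSet_le [IsProbabilityMeasure P] [IsProbabilityMeasure ν]
    (hK : 2 ≤ K) (h : IsRun ν P r c I) (hν : ∀ᵐ x ∂ν, ∀ k, x k ∈ Set.Icc (0 : ℝ) 1) (m : ℕ) :
    P.real (failSet ν r c I m) ≤ delta K (m + 1) := by
  have abs_split : ∀ (f g : Ω → ℝ), {ω | g ω < |f ω|}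
      ⊆ {ω | g ω < 1 * f ω} ∪ {ω | g ω < (-1) * f ω} := by
    intro f g ω hω
    rcases lt_abs.1 (show g ω < |f ω| from hω) with h1 | h1
    · left; simpa using h1
    · right; simpa using h1
  have h1 : (1 : ℝ) ^ 2 = 1 := by norm_num
  have h2 : (-1 : ℝ) ^ 2 = 1 := by norm_num
  have two_sided : ∀ (f g : Ω → ℝ),
      P.real {ω | g ω < 1 * f ω} ≤ Real.exp (-confLog K (m + 1)) →
      P.real {ω | g ω < (-1) * f ω} ≤ Real.exp (-confLog K (m + 1)) →
      P.real {ω | g ω < |f ω|} ≤ 2 * Real.exp (-confLog K (m + 1)) := fun f g ha hb =>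
    (measureReal_mono (abs_split f g)).trans
      ((measureReal_union_le _ _).trans (by linarith))
  calc P.real (failSet ν r c I m) ≤ ∑ k : Fin K, 4 * Real.exp (-confLog K (m + 1)) := by
        refine (measureReal_iUnion_fintype_le _).trans (Finset.sum_le_sum fun k _ => ?_)
        refine (measureReal_union_le _ _).trans ?_
        have hA := two_sided _ _ (h.measureReal_armDev_gt_le hK m k h1)
          (h.measureReal_armDev_gt_le hK m k h2)
        have hR := two_sided _ _ (h.measureReal_rewDev_gt_le hK hν m k h1)
          (h.measureReal_rewDev_gt_le hK hν m k h2)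
        linarith
    _ = delta K (m + 1) := by
        have : (0 : ℝ) < K := by positivity
        rw [Finset.sum_const, Finset.card_univ, Fintype.card_fin, nsmul_eq_mul,
          exp_neg_confLog hK, beta]
        field_simp

theorem IsRun.measurableSet_failSet (h : IsRun ν P r c I) (m : ℕ) :
    MeasurableSet (failSet ν r c I m) := by
  refine MeasurableSet.iUnion fun k => MeasurableSet.union ?_ ?_
  · exact measurableSet_lt (((h.measurable_runPulls m k).const_mul _).sqrt.const_mul 2)
      ((measurable_armDev_history (r := r) m _ k).mono (h.history_le _) le_rfl).abs
  · exact measurableSet_lt measurable_const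
      ((measurable_rewDev_history (c := c) (I := I) m _ k).mono (h.history_le _) le_rfl).abs

end Run

end

/-! ### From rounds to epochs: the expected regret -/

noncomputable section

variable {Ω : Type*} {K : ℕ}

theorem epochEnd_strictMono (hK : 2 ≤ K) : StrictMono (epochEnd K) :=
  strictMono_nat_of_lt_succ fun m => by
    have : 0 < epochLen K (m + 1) := by exact_mod_cast epochLen_pos hK m
    rw [epochEnd]
    omega

theorem exists_epoch (hK : 2 ≤ K) {T : ℕ} (hT : 0 < T) :
    ∃ M, epochEnd K M < T ∧ T ≤ epochEnd K (M + 1) := by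
  have hex : ∃ n, T ≤ epochEnd K n := ⟨T, (epochEnd_strictMono hK).le_apply⟩
  classical
  have h0 : Nat.find hex ≠ 0 := fun h => by
    have := Nat.find_spec hex
    rw [h, epochEnd] at this
    omega
  obtain ⟨M, hM⟩ := Nat.exists_eq_succ_of_ne_zero h0
  have hspec := Nat.find_spec hex
  rw [hM] at hspec
  exact ⟨M, not_le.1 (Nat.find_min hex (by omega)), hspec⟩

theorem sum_range_epochEnd (f : ℕ → ℝ) (M : ℕ) : ∑ t ∈ Finset.range (epochEnd K M), f t
    = ∑ m ∈ Finset.range M, ∑ t ∈ Finset.Ico (epochEnd K m) (epochEnd K (m + 1)), f t := by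
  induction M with
  | zero => simp [epochEnd]
  | succ M ih =>
    rw [Finset.sum_range_succ, ← ih]
    exact (Finset.sum_range_add_sum_Ico f (Nat.le_add_right _ _)).symm

theorem corruption_epochEnd (r c : ℕ → Ω → Fin K → ℝ) (M : ℕ) (ω : Ω) :
    ∑ m ∈ Finset.range M, epochCorruption r c m ω = corruption r c (epochEnd K M) ω :=
  (sum_range_epochEnd _ M).symm

theorem corruption_mono (r c : ℕ → Ω → Fin K → ℝ) (ω : Ω) :
    Monotone fun T => corruption r c T ω := fun _ _ hST =>
  Finset.sum_le_sum_of_subset_of_nonneg (Finset.range_mono hST) fun _ _ _ =>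
    Real.iSup_nonneg fun _ => abs_nonneg _

section Gaps

variable {ν : Measure (Fin K → ℝ)}

theorem exists_best (hK : 2 ≤ K) (ν : Measure (Fin K → ℝ)) :
    ∃ b, (∀ j, mean ν j ≤ mean ν b) ∧ ∀ k, gap ν k = mean ν b - mean ν k := by
  have : Nonempty (Fin K) := ⟨⟨0, by omega⟩⟩
  obtain ⟨b, hb⟩ := Finite.exists_max (mean ν)
  refine ⟨b, hb, fun k => ?_⟩
  rw [gap, le_antisymm (ciSup_le hb) (le_ciSup (Set.finite_range _).bddAbove b)]

theorem minGap_mem (h : ∃ k, 0 < gap ν k) : 0 < minGap ν ∧ ∃ k, gap ν k = minGap ν := by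
  have hfin : {d | 0 < d ∧ ∃ k, gap ν k = d}.Finite :=
    (Set.finite_range (gap ν)).subset fun d hd => hd.2
  obtain ⟨k, hk⟩ := h
  have hne : {d | 0 < d ∧ ∃ k, gap ν k = d}.Nonempty := ⟨gap ν k, hk, k, rfl⟩
  exact hne.csInf_mem hfin

theorem minGap_le {k : Fin K} (h : 0 < gap ν k) : minGap ν ≤ gap ν k :=
  csInf_le ⟨0, fun _ hd => hd.1.le⟩ ⟨h, k, rfl⟩

end Gaps

section Run

variable [mΩ : MeasurableSpace Ω] {ν : Measure (Fin K → ℝ)} {P : Measure Ω}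
  {r c : ℕ → Ω → Fin K → ℝ} {I : ℕ → Ω → Fin K}

theorem IsRun.integral_reward (h : IsRun ν P r c I) (t : ℕ) (k : Fin K) :
    ∫ ω, r t ω k ∂P = mean ν k := by
  rw [mean, ← h.reward_law t, integral_map (h.measurable_reward t).aemeasurable
    (measurable_pi_apply k).aestronglyMeasurable]

theorem IsRun.ae_abs_reward_le (h : IsRun ν P r c I)
    (hν : ∀ᵐ x ∂ν, ∀ k, x k ∈ Set.Icc (0 : ℝ) 1) :
    ∀ᵐ ω ∂P, ∀ t k, |r t ω k| ≤ 1 := by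
  filter_upwards [h.ae_reward_mem hν] with ω hω t k
  rw [abs_of_nonneg (hω t k).1]
  exact (hω t k).2

theorem IsRun.measurable_reward_apply (h : IsRun ν P r c I) (t : ℕ) (k : Fin K) :
    Measurable fun ω => r t ω k :=
  (measurable_pi_apply k).comp (h.measurable_reward t)

theorem IsRun.measurable_corruption (h : IsRun ν P r c I) (T : ℕ) :
    Measurable (corruption r c T) :=
  Finset.measurable_sum _ fun t _ => Measurable.iSup fun k =>
    (((measurable_pi_apply k).comp (h.measurable_corrupted t)).sub
      (h.measurable_reward_apply t k)).abs

variable [IsProbabilityMeasure P]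

theorem IsRun.integrable_runProb (hK : 2 ≤ K) (h : IsRun ν P r c I) (m : ℕ) (k : Fin K) :
    Integrable (runProb c I m k) P :=
  integrable_of_ae_bound (h.measurable_runProb m k) (B := 1) (Filter.Eventually.of_forall fun ω => by
    rw [abs_of_nonneg (runProb_nonneg hK m k ω)]; exact runProb_le_one hK m k ω)

/-- Averaging over the draw replaces the indicator by the sampling probability, which is determined
by the history and hence independent of the reward of the round. -/
theorem IsRun.integral_reward_arm (h : IsRun ν P r c I)
    (hν : ∀ᵐ x ∂ν, ∀ k, x k ∈ Set.Icc (0 : ℝ) 1) {m t : ℕ} (h1 : epochEnd K m ≤ t)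
    (h2 : t < epochEnd K (m + 1)) :
    ∫ ω, r t ω (I t ω) ∂P = ∑ k, mean ν k * ∫ ω, runProb c I m k ω ∂P := by
  have hb := h.ae_abs_reward_le hν
  have e : ∀ ω, r t ω (I t ω) = ∑ k, r t ω k * armInd I t k ω := fun ω => by
    simp [armInd_eq_ite]
  simp_rw [e]
  rw [integral_finsetSum _ fun k _ => ?_]
  · refine Finset.sum_congr rfl fun k _ => ?_
    rw [h.integral_mul_armInd h1 h2 k (H := fun ω => r t ω k) (B := 1)
      ((measurable_pi_apply k).comp (measurable_reward_beforePull r c I t))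
      (by filter_upwards [hb] with ω hω using hω t k)]
    have := h.integral_mul_reward t (((measurable_runProb_history (r := r) (c := c) (I := I) m k).mono
      (history_mono r c I h1) le_rfl)) (f := fun x => x k) (measurable_pi_apply k)
    rw [mul_comm (mean ν k), mean, ← this]
    exact integral_congr_ae (Filter.Eventually.of_forall fun ω => mul_comm _ _)
  · refine integrable_of_ae_bound (B := 1)
      ((h.measurable_reward_apply t k).mul (h.measurable_armInd t k)) ?_
    filter_upwards [hb] with ω hω
    rw [abs_mul]
    refine mul_le_one₀ (hω t k) (abs_nonneg _) ?_
    rw [abs_of_nonneg (armInd_nonneg t k ω)]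
    exact armInd_le_one t k ω

theorem IsRun.sum_integral_runProb (hK : 2 ≤ K) (h : IsRun ν P r c I) (m : ℕ) :
    ∑ k, ∫ ω, runProb c I m k ω ∂P = 1 := by
  rw [← integral_finsetSum _ fun k _ => h.integrable_runProb hK m k]
  simp_rw [runProb, sum_sampleProb hK]
  simp

theorem IsRun.integrable_runPulls (hK : 2 ≤ K) (h : IsRun ν P r c I) (m : ℕ) (k : Fin K) :
    Integrable (fun ω => pulls (m + 1) (runState c I m ω) k) P :=
  integrable_of_ae_bound (h.measurable_runPulls m k) (B := epochLen K (m + 1))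
    (Filter.Eventually.of_forall fun ω => by
      have hpos : 0 < pulls (m + 1) (runState c I m ω) k :=
        pulls_pos hK (le_state_estGap _ _ m) k
      rw [abs_of_pos hpos]
      exact pulls_le hK (le_state_estGap _ _ m) k)

theorem IsRun.integrable_reward_arm (h : IsRun ν P r c I)
    (hν : ∀ᵐ x ∂ν, ∀ k, x k ∈ Set.Icc (0 : ℝ) 1) (t : ℕ) :
    Integrable (fun ω => r t ω (I t ω)) P := by
  refine integrable_of_ae_bound (B := 1)
    (measurable_eval_arm (h.measurable_reward t) (h.measurable_arm t)) ?_
  filter_upwards [h.ae_abs_reward_le hν] with ω hω using hω t _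

/-- Regret of a round in epoch `m + 1`. -/
theorem IsRun.round_regret (hK : 2 ≤ K) (h : IsRun ν P r c I)
    (hν : ∀ᵐ x ∂ν, ∀ k, x k ∈ Set.Icc (0 : ℝ) 1) {m t : ℕ} (h1 : epochEnd K m ≤ t)
    (h2 : t < epochEnd K (m + 1)) (b : Fin K) :
    mean ν b - ∫ ω, r t ω (I t ω) ∂P
      = ∑ k, (mean ν b - mean ν k) * ∫ ω, runProb c I m k ω ∂P := by
  rw [h.integral_reward_arm hν h1 h2]
  simp_rw [sub_mul]
  rw [Finset.sum_sub_distrib, ← Finset.mul_sum, h.sum_integral_runProb hK, mul_one]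

/-- The regret up to time `T` is at most that of the epochs begun before `T`. -/
theorem IsRun.pseudoRegret_le (hK : 2 ≤ K) (h : IsRun ν P r c I)
    (hν : ∀ᵐ x ∂ν, ∀ k, x k ∈ Set.Icc (0 : ℝ) 1) {b : Fin K}
    (hb : ∀ j, mean ν j ≤ mean ν b) {T M : ℕ} (hT : T ≤ epochEnd K M) :
    pseudoRegret P r I T ≤ ∫ ω, ∑ m ∈ Finset.range M,
      ∑ k, (mean ν b - mean ν k) * pulls (m + 1) (runState c I m ω) k ∂P := by
  have : Nonempty (Fin K) := ⟨b⟩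
  have hsum : ∀ k, ∫ ω, ∑ t ∈ Finset.range T, r t ω k ∂P = T * mean ν k := fun k => by
    rw [integral_finsetSum]
    · simp [h.integral_reward]
    · intro t _
      refine integrable_of_ae_bound (B := 1) (h.measurable_reward_apply t k) ?_
      filter_upwards [h.ae_abs_reward_le hν] with ω hω using hω t k
  have hsup : (⨆ k, ∫ ω, ∑ t ∈ Finset.range T, r t ω k ∂P) ≤ T * mean ν b := by
    refine ciSup_le fun k => ?_
    rw [hsum]
    exact mul_le_mul_of_nonneg_left (hb k) (Nat.cast_nonneg _)
  have hround : ∀ t < epochEnd K M, 0 ≤ mean ν b - ∫ ω, r t ω (I t ω) ∂P := fun t _ => by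
    -- Applied to `t + 1`, so that the strict and weak bounds become `epochEnd K m ≤ t < epochEnd K
    -- (m + 1)`.
    obtain ⟨m, h1, h2⟩ := exists_epoch hK (Nat.succ_pos t)
    rw [h.round_regret hK hν (Nat.lt_succ_iff.1 h1) h2 b]
    exact Finset.sum_nonneg fun k _ => mul_nonneg (sub_nonneg.2 (hb k))
      (integral_nonneg fun ω => runProb_nonneg hK m k ω)
  calc pseudoRegret P r I T
      ≤ T * mean ν b - ∑ t ∈ Finset.range T, ∫ ω, r t ω (I t ω) ∂P := by
        rw [pseudoRegret, integral_finsetSum _ fun t _ => h.integrable_reward_arm hν t]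
        linarith
    _ = ∑ t ∈ Finset.range T, (mean ν b - ∫ ω, r t ω (I t ω) ∂P) := by
        rw [Finset.sum_sub_distrib]; simp
    _ ≤ ∑ t ∈ Finset.range (epochEnd K M), (mean ν b - ∫ ω, r t ω (I t ω) ∂P) :=
        Finset.sum_le_sum_of_subset_of_nonneg (Finset.range_mono hT) fun t ht _ =>
          hround t (Finset.mem_range.1 ht)
    _ = ∑ m ∈ Finset.range M, ∫ ω, ∑ k, (mean ν b - mean ν k)
          * pulls (m + 1) (runState c I m ω) k ∂P := by
        rw [sum_range_epochEnd]
        refine Finset.sum_congr rfl fun m _ => ?_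
        rw [Finset.sum_congr rfl fun t ht => h.round_regret hK hν (Finset.mem_Ico.1 ht).1
          (Finset.mem_Ico.1 ht).2 b, Finset.sum_const, Nat.card_Ico, epochEnd,
          Nat.add_sub_cancel_left, nsmul_eq_mul, Finset.mul_sum,
          integral_finsetSum _ fun k _ => (h.integrable_runPulls hK m k).const_mul _]
        refine Finset.sum_congr rfl fun k _ => ?_
        rw [integral_const_mul, mul_left_comm, ← integral_const_mul]
        congr 2
        ext ω
        rw [mul_comm, runProb, sampleProb_mul_epochLen hK]
    _ = _ := (integral_finsetSum _ fun m _ => integrable_finsetSum _ fun k _ =>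
        (h.integrable_runPulls hK m k).const_mul _).symm

theorem IsRun.integrable_corruption (hK : 2 ≤ K) (h : IsRun ν P r c I)
    (hν : ∀ᵐ x ∂ν, ∀ k, x k ∈ Set.Icc (0 : ℝ) 1) (T : ℕ) :
    Integrable (corruption r c T) P := by
  have : Nonempty (Fin K) := ⟨⟨0, by omega⟩⟩
  refine integrable_of_ae_bound (B := T) (h.measurable_corruption T) ?_
  filter_upwards [h.ae_reward_mem hν, h.ae_corrupted_mem] with ω h1 h2
  have hnn : 0 ≤ corruption r c T ω :=
    Finset.sum_nonneg fun _ _ => Real.iSup_nonneg fun _ => abs_nonneg _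
  rw [abs_of_nonneg hnn]
  refine (Finset.sum_le_card_nsmul _ _ 1 fun t _ => ciSup_le fun k => ?_).trans (by simp)
  rw [abs_le]
  constructor <;> linarith [(h1 t k).1, (h1 t k).2, (h2 t k).1, (h2 t k).2]

/-- Regret bound in terms of the epoch parameters. -/
theorem IsRun.pseudoRegret_le_epochs [IsProbabilityMeasure ν] (hK : 2 ≤ K)
    (h : IsRun ν P r c I) (hν : ∀ᵐ x ∂ν, ∀ k, x k ∈ Set.Icc (0 : ℝ) 1) {T M : ℕ}
    (hM : epochEnd K M < T) (hT : T ≤ epochEnd K (M + 1)) :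
    pseudoRegret P r I T ≤
      22 * (∑ m ∈ Finset.range (M + 1), lam K (m + 1)) * ∑ k with 0 < gap ν k, 1 / gap ν k
      + 912 * ((∫ ω, corruption r c T ω ∂P) + 13 * M)
      + ∑ m ∈ Finset.range M, if minGap ν ≤ (2 ^ (m + 1))⁻¹ then
          epochLen K (m + 2) * ((2 : ℝ) ^ (m + 1))⁻¹ else 0 := by
  obtain ⟨b, hb, hgap⟩ := exists_best hK ν
  have hμ0 := mean_nonneg hν
  have hμ1 := mean_le_one hν
  set G := ∑ k with 0 < gap ν k, 1 / gap ν k with hG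
  set W := ∑ m ∈ Finset.range M, (if minGap ν ≤ (2 ^ (m + 1))⁻¹ then
          epochLen K (m + 2) * ((2 : ℝ) ^ (m + 1))⁻¹ else 0) with hW
  set X := 22 * (∑ m ∈ Finset.range (M + 1), lam K (m + 1)) * G with hX
  have hG' : G = ∑ k with 0 < mean ν b - mean ν k, 1 / (mean ν b - mean ν k) := by
    simp only [hG, hgap]
  have hD : ∀ k, 0 < mean ν b - mean ν k → minGap ν ≤ mean ν b - mean ν k := fun k hk => by
    rw [← hgap] at hk ⊢
    exact minGap_le hk
  let F : ℕ → Ω → ℝ := fun m => (failSet ν r c I m).indicator fun _ => 1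
  have hFint : ∀ m, Integrable (F m) P := fun m =>
    (integrable_const (1 : ℝ)).indicator (h.measurableSet_failSet m)
  have hFle : ∀ m, epochLen K (m + 1) * ∫ ω, F m ω ∂P ≤ 13 := fun m => by
    have h1 : ∫ ω, F m ω ∂P = P.real (failSet ν r c I m) := by
      simp only [F]
      rw [integral_indicator (h.measurableSet_failSet m)]
      simp
    rw [h1]
    exact (mul_le_mul_of_nonneg_left (h.measureReal_failSet_le hK hν m)
      (Nat.cast_nonneg _)).trans (epochLen_mul_delta_le hK m)
  have hpt : ∀ᵐ ω ∂P, ∑ m ∈ Finset.range (M + 1),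
      ∑ k, (mean ν b - mean ν k) * pulls (m + 1) (runState c I m ω) k
      ≤ X + 912 * (corruption r c T ω + ∑ m ∈ Finset.range M, epochLen K (m + 1) * F m ω) + W := by
    filter_upwards [h.ae_corrupted_mem] with ω hω
    have hacc := accurate_of_bounds (ν := ν) (r := r) (c := c) (I := I) hK hμ0 hμ1
      (fun t k => (hω t k).1)
    have hg0 : ∀ m, 0 ≤ errLevel ν r c I m ω := fun m => errLevel_nonneg m ω
    rw [Finset.sum_range_succ']
    have h1 : ∑ k, (mean ν b - mean ν k) * pulls (0 + 1) (runState c I 0 ω) k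
        ≤ 22 * lam K 1 * G := by
      rw [hG']
      exact sum_gap_mul_pulls_first_le hK hb fun k => by linarith [hμ0 k, hμ1 b]
    have h2 := Finset.sum_le_sum fun m (_ : m ∈ Finset.range M) =>
      sum_gap_mul_pulls_le (m := m) hK hg0 (fun i _ => hacc i) hb hD
    rw [Finset.sum_add_distrib, Finset.sum_add_distrib, ← Finset.mul_sum, ← hG', ← hW,
      ← Finset.sum_mul, ← Finset.mul_sum] at h2
    have h3 := sum_mul_discounted_le (N := fun m => (epochLen K (m + 1) : ℝ))
      (g := fun m => errLevel ν r c I m ω) (fun m => Nat.cast_nonneg _)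
      (fun m => epochLen_succ_le hK m) hg0 M
    have h4 : ∑ m ∈ Finset.range M, epochLen K (m + 1) * errLevel ν r c I m ω
        ≤ corruption r c T ω + ∑ m ∈ Finset.range M, epochLen K (m + 1) * F m ω := by
      have : ∀ m, epochLen K (m + 1) * errLevel ν r c I m ω
          = epochCorruption r c m ω + epochLen K (m + 1) * F m ω := fun m => by
        rw [errLevel, mul_add, mul_div_cancel₀ _ (epochLen_pos hK m).ne']
      simp_rw [this]
      rw [Finset.sum_add_distrib, corruption_epochEnd]
      exact add_le_add (corruption_mono r c ω hM.le) le_rfl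
    have h5 : X = 22 * (∑ m ∈ Finset.range M, lam K (m + 2)) * G + 22 * lam K 1 * G := by
      rw [hX, Finset.sum_range_succ']
      ring
    rw [h5]
    change ∑ m ∈ Finset.range M, ∑ k, (mean ν b - mean ν k)
      * pulls (m + 2) (runState c I (m + 1) ω) k ≤ _ at h2
    change ∑ m ∈ Finset.range M, ∑ k, (mean ν b - mean ν k)
      * pulls (m + 2) (runState c I (m + 1) ω) k + _ ≤ _
    have h3' : ∑ m ∈ Finset.range M, epochLen K (m + 2)
        * discounted (fun m => errLevel ν r c I m ω) (m + 1)
        ≤ 24 * ∑ m ∈ Finset.range M, epochLen K (m + 1) * errLevel ν r c I m ω := h3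
    linarith
  have hFsum : Integrable (fun ω => ∑ m ∈ Finset.range M, epochLen K (m + 1) * F m ω) P :=
    integrable_finsetSum _ fun m _ => (hFint m).const_mul _
  have hCint := h.integrable_corruption hK hν T
  have hCF : Integrable (fun ω => 912 * (corruption r c T ω
      + ∑ m ∈ Finset.range M, epochLen K (m + 1) * F m ω)) P := (hCint.add hFsum).const_mul _
  have hXCF : Integrable (fun ω => X + 912 * (corruption r c T ω
      + ∑ m ∈ Finset.range M, epochLen K (m + 1) * F m ω)) P := (integrable_const X).add hCF
  have hrhs : Integrable (fun ω => X + 912 * (corruption r c T ω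
      + ∑ m ∈ Finset.range M, epochLen K (m + 1) * F m ω) + W) P :=
    hXCF.add (integrable_const W)
  refine (h.pseudoRegret_le hK hν hb hT).trans ((integral_mono_ae
    (integrable_finsetSum _ fun m _ => integrable_finsetSum _ fun k _ =>
      (h.integrable_runPulls hK m k).const_mul _) hrhs hpt).trans ?_)
  rw [integral_add hXCF (integrable_const W),
    integral_add (integrable_const X) hCF, integral_const_mul 912, integral_add hCint hFsum,
    integral_finsetSum _ fun m _ => (hFint m).const_mul _]
  simp only [integral_const, probReal_univ, one_smul, integral_const_mul]
  have h6 : ∑ m ∈ Finset.range M, epochLen K (m + 1) * ∫ ω, F m ω ∂P ≤ 13 * M := by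
    refine (Finset.sum_le_card_nsmul _ _ 13 fun m _ => hFle m).trans (le_of_eq ?_)
    rw [Finset.card_range, nsmul_eq_mul, mul_comm]
  linarith

end Run

end

/-! ### Summing the epoch parameters -/

noncomputable section

variable {K : ℕ}

theorem four_pow_le_epochEnd (hK : 2 ≤ K) (m : ℕ) : (4 : ℝ) ^ m ≤ epochEnd K (m + 1) := by
  have h1 := le_epochLen K m
  have h2 := five_le_confLog hK (m + 1)
  have h3 : (2 : ℝ) ≤ K := by exact_mod_cast hK
  have h4 : 1 ≤ K * lam K (m + 1) := by rw [lam_eq]; nlinarith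
  have h5 : (4 : ℝ) ^ m ≤ K * lam K (m + 1) * 4 ^ m := le_mul_of_one_le_left (by positivity) h4
  rw [epochEnd]
  push_cast
  have : (0 : ℝ) ≤ epochEnd K m := Nat.cast_nonneg _
  linarith

/-- The number of epochs begun before time `T` is logarithmic in `T`. -/
theorem epochs_le_log (hK : 2 ≤ K) {T M : ℕ} (hT : 2 ≤ T) (hM : epochEnd K M < T) :
    (M : ℝ) + 1 ≤ 4 * Real.log T := by
  have hl2 := Real.log_two_gt_d9
  have hlT := log_two_le_log hT
  cases M with
  | zero => push_cast; linarith
  | succ m =>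
    have h1 : (4 : ℝ) ^ m ≤ T := (four_pow_le_epochEnd hK m).trans (by exact_mod_cast hM.le)
    have h2 := Real.log_le_log (by positivity) h1
    rw [show (4 : ℝ) = 2 ^ 2 by norm_num, ← pow_mul, Real.log_pow] at h2
    push_cast at h2 ⊢
    have h3 : (0 : ℝ) ≤ m := Nat.cast_nonneg _
    nlinarith

theorem sum_lam_le (hK : 2 ≤ K) {T M : ℕ} (hT : 2 ≤ T) (hM : epochEnd K M < T) :
    ∑ m ∈ Finset.range (M + 1), lam K (m + 1) ≤ 90112 * (Real.log T * Real.log (K * T)) := by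
  have hl2 := Real.log_two_gt_d9
  have hl2' := Real.log_two_lt_d9
  have hlT := log_two_le_log hT
  have hlK := log_two_le_log hK
  have hME := epochs_le_log hK hT hM
  have hK0 : (K : ℝ) ≠ 0 := by positivity
  have hT0 : (T : ℝ) ≠ 0 := by positivity
  -- By `M + 1 ≤ 4 ln T`, the logarithm is at most `3 ln K + 88 ln T`, and `256 · 88 = 22528`.
  have hterm : ∀ m ∈ Finset.range (M + 1), lam K (m + 1) ≤ 22528 * Real.log (K * T) := by
    intro m hm
    have hm' : (m : ℝ) ≤ M := by exact_mod_cast Nat.lt_succ_iff.1 (Finset.mem_range.1 hm)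
    have h1 := confLog_le hK (m + 1)
    rw [lam_eq, Real.log_mul hK0 hT0]
    push_cast at h1
    have h2 : (4 * ((m : ℝ) + 1) + 18) * Real.log 2 ≤ 88 * Real.log T := by
      have h3 : 4 * ((m : ℝ) + 1) + 18 ≤ 22 * (M + 1) := by
        have : (0 : ℝ) ≤ m := Nat.cast_nonneg _
        linarith
      have h4 : (4 * ((m : ℝ) + 1) + 18) * Real.log 2 ≤ (4 * ((m : ℝ) + 1) + 18) * 1 := by
        gcongr
        linarith
      linarith
    linarith
  have hlog : 0 ≤ Real.log (K * T) := by
    rw [Real.log_mul hK0 hT0]; linarith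
  refine (Finset.sum_le_card_nsmul _ _ _ hterm).trans ?_
  rw [Finset.card_range, nsmul_eq_mul]
  push_cast
  have := mul_le_mul_of_nonneg_right hME (by positivity : 0 ≤ 22528 * Real.log (K * T))
  linarith

/-- Cost of the epochs whose leader may be suboptimal although its estimates are accurate. -/
theorem sum_leader_cost_le (hK : 2 ≤ K) {D : ℝ} (hD0 : 0 < D) (hD1 : D ≤ 1) (M : ℕ) :
    ∑ m ∈ Finset.range M, (if D ≤ (2 ^ (m + 1))⁻¹ then
      epochLen K (m + 2) * ((2 : ℝ) ^ (m + 1))⁻¹ else 0)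
      ≤ 30720 * (K * Real.log (1 / D) * Real.log (K / D) / D) := by
  have hl2 := Real.log_two_gt_d9
  have hK0 : (0 : ℝ) < K := by positivity
  have hlK := log_two_le_log hK
  have hD' : 1 ≤ 1 / D := (one_le_div hD0).2 hD1
  have hlD : 0 ≤ Real.log (1 / D) := Real.log_nonneg hD'
  have hKD : Real.log (K / D) = Real.log K + Real.log (1 / D) := by
    rw [← Real.log_mul hK0.ne' (by positivity), mul_one_div]
  have hpow : ∀ m : ℕ, D ≤ ((2 : ℝ) ^ (m + 1))⁻¹ →
      (2 : ℝ) ^ (m + 1) ≤ 1 / D ∧ ((m : ℝ) + 1) * Real.log 2 ≤ Real.log (1 / D) := by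
    intro m hm
    have h1 : (2 : ℝ) ^ (m + 1) ≤ 1 / D := by
      rw [one_div]; exact le_inv_of_le_inv₀ hD0 hm
    refine ⟨h1, ?_⟩
    have := Real.log_le_log (by positivity) h1
    rw [Real.log_pow] at this
    push_cast at this
    exact this
  rw [← Finset.sum_filter]
  have hterm : ∀ m ∈ (Finset.range M).filter fun m => D ≤ ((2 : ℝ) ^ (m + 1))⁻¹,
      epochLen K (m + 2) * ((2 : ℝ) ^ (m + 1))⁻¹ ≤ 15360 * (K * Real.log (K / D) / D) := by
    intro m hm
    obtain ⟨h1, h2⟩ := hpow m (Finset.mem_filter.1 hm).2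
    have h3 : (epochLen K (m + 2) : ℝ) ≤ 2 * (K * lam K (m + 2) * 4 ^ (m + 1)) :=
      epochLen_le hK (m + 1)
    -- `m ln 2` is bounded by `ln(1/D)` and the constant multiples of `ln 2` by multiples of `ln K`.
    have h4 : confLog K (m + 2) ≤ 30 * Real.log (K / D) := by
      have h5 := confLog_le hK (m + 2)
      push_cast at h5
      have h6 : (0 : ℝ) ≤ m * Real.log 2 := by positivity
      rw [hKD]
      linarith
    have hlKD : 0 ≤ Real.log (K / D) := by rw [hKD]; linarith
    calc epochLen K (m + 2) * ((2 : ℝ) ^ (m + 1))⁻¹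
        ≤ 2 * (K * lam K (m + 2) * 4 ^ (m + 1)) * ((2 : ℝ) ^ (m + 1))⁻¹ := by gcongr
      _ = 512 * K * confLog K (m + 2) * 2 ^ (m + 1) := by
        rw [lam_eq, ← two_pow_two_mul, mul_comm 2 (m + 1), pow_mul]
        field_simp
        ring
      _ ≤ 512 * K * (30 * Real.log (K / D)) * (1 / D) := by
        have := five_le_confLog hK (m + 2)
        gcongr
      _ = _ := by ring
  -- The epochs concerned satisfy `(m + 1) ln 2 ≤ ln(1/D)`, and `1 / ln 2 < 2`.
  have hcard : (((Finset.range M).filter fun m => D ≤ ((2 : ℝ) ^ (m + 1))⁻¹).card : ℝ)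
      ≤ 2 * Real.log (1 / D) := by
    have hsub : ((Finset.range M).filter fun m => D ≤ ((2 : ℝ) ^ (m + 1))⁻¹)
        ⊆ Finset.range ⌊2 * Real.log (1 / D)⌋₊ := by
      intro m hm
      have h2 := (hpow m (Finset.mem_filter.1 hm).2).2
      rw [Finset.mem_range, Nat.lt_iff_add_one_le, Nat.le_floor_iff (by positivity)]
      push_cast
      have : (0 : ℝ) ≤ m := Nat.cast_nonneg _
      nlinarith
    calc _ ≤ ((Finset.range ⌊2 * Real.log (1 / D)⌋₊).card : ℝ) := by
          exact_mod_cast Finset.card_le_card hsub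
      _ ≤ _ := by rw [Finset.card_range]; exact Nat.floor_le (by positivity)
  refine (Finset.sum_le_card_nsmul _ _ _ hterm).trans ?_
  rw [nsmul_eq_mul]
  have hnn : 0 ≤ 15360 * (K * Real.log (K / D) / D) := by
    have hlKD : 0 ≤ Real.log (K / D) := by rw [hKD]; linarith
    positivity
  refine (mul_le_mul_of_nonneg_right hcard hnn).trans (le_of_eq ?_)
  ring

end

end Barbat

/-! ### The regret bound -/

open MeasureTheory Barbat in
theorem theorem1 :
    ∃ A : ℝ, 0 < A ∧
      ∀ (K : ℕ), 2 ≤ K →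
      ∀ (ν : Measure (Fin K → ℝ)), IsProbabilityMeasure ν →
        (∀ᵐ x ∂ν, ∀ k, x k ∈ Set.Icc (0 : ℝ) 1) →
      ∀ (Ω : Type*) [MeasurableSpace Ω] (P : Measure Ω) [IsProbabilityMeasure P]
        (r c : ℕ → Ω → Fin K → ℝ) (I : ℕ → Ω → Fin K), IsRun ν P r c I →
      ∀ (T : ℕ), 2 ≤ T →
        pseudoRegret P r I T ≤
          A * ((∫ ω, corruption r c T ω ∂P)
            + ∑ k with 0 < gap ν k, Real.log T * Real.log (K * T) / gap ν k
            + K * Real.log (1 / minGap ν) * Real.log (K / minGap ν) / minGap ν) := by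
  -- The coefficient of the middle term dominates: `22 · 90112 + 912 · 13 · 4` is about `2.03 ·
  -- 10⁶`; the others are `912` and `30720`.
  refine ⟨3000000, by norm_num, ?_⟩
  intro K hK ν _ hν Ω _ P _ r c I h T hT
  have hC : 0 ≤ ∫ ω, corruption r c T ω ∂P := integral_nonneg fun ω =>
    Finset.sum_nonneg fun _ _ => Real.iSup_nonneg fun _ => abs_nonneg _
  by_cases hpos : ∃ k, 0 < gap ν k
  · obtain ⟨M, hM, hTM⟩ := exists_epoch hK (by omega : 0 < T)
    have hreg := h.pseudoRegret_le_epochs hK hν hM hTM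
    have hgap1 : ∀ k, gap ν k ≤ 1 := fun k => by
      obtain ⟨b, _, hgap⟩ := exists_best hK ν
      rw [hgap]
      linarith [mean_nonneg hν k, mean_le_one hν b]
    obtain ⟨hD0, k₀, hk₀⟩ := minGap_mem hpos
    have hW := sum_leader_cost_le hK hD0 (hk₀ ▸ hgap1 k₀) M
    have hlam := sum_lam_le hK hT hM
    have hMlog := epochs_le_log hK hT hM
    have hlT := log_two_le_log hT
    have hlK := log_two_le_log hK
    have hl2 := Real.log_two_gt_d9
    have hlKT : 1 ≤ Real.log (K * T) := by
      rw [Real.log_mul (by positivity) (by positivity)]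
      linarith
    -- Gaps are at most `1`, so the sum of their inverses is at least `1`. This absorbs the `O(log
    -- T)` cost of failed epochs into the middle term.
    have hG : 1 ≤ ∑ k with 0 < gap ν k, 1 / gap ν k := by
      obtain ⟨k, hk⟩ := hpos
      refine ((one_le_div hk).2 (hgap1 k)).trans
        (Finset.single_le_sum (f := fun k => 1 / gap ν k) (fun j hj => ?_) (by simpa using hk))
      exact (one_div_pos.2 (Finset.mem_filter.1 hj).2).le
    have hsum : ∑ k with 0 < gap ν k, Real.log T * Real.log (K * T) / gap ν k
        = Real.log T * Real.log (K * T) * ∑ k with 0 < gap ν k, 1 / gap ν k := by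
      rw [Finset.mul_sum]
      exact Finset.sum_congr rfl fun k _ => by ring
    rw [hsum]
    set G := ∑ k with 0 < gap ν k, 1 / gap ν k
    have h1 := mul_le_mul_of_nonneg_right hlam (by linarith : 0 ≤ G)
    have hll : Real.log T ≤ Real.log T * Real.log (K * T) :=
      le_mul_of_one_le_right (by linarith) hlKT
    have h2 : Real.log T ≤ Real.log T * Real.log (K * T) * G :=
      hll.trans (le_mul_of_one_le_right (by linarith) hG)
    have h3 : 0 ≤ K * Real.log (1 / minGap ν) * Real.log (K / minGap ν) / minGap ν := by
      have := (Finset.sum_nonneg fun m (_ : m ∈ Finset.range M) => by positivity).trans hW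
      linarith
    linarith
  · obtain ⟨b, hb, hgap⟩ := exists_best hK ν
    have hzero : ∀ k, mean ν b - mean ν k = 0 := fun k =>
      le_antisymm (by rw [← hgap]; exact not_lt.1 fun hk => hpos ⟨k, hk⟩) (sub_nonneg.2 (hb k))
    have hset : minGap ν = 0 := by
      have : {d | 0 < d ∧ ∃ k, gap ν k = d} = ∅ := by
        ext d
        simp only [Set.mem_ofPred_eq, Set.mem_empty_iff_false, iff_false]
        rintro ⟨hd, k, rfl⟩
        exact hpos ⟨k, hd⟩
      rw [minGap, this, Real.sInf_empty]
    have hfilter : (Finset.univ.filter fun k => 0 < gap ν k) = ∅ :=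
      Finset.filter_false_of_mem fun k _ hk => hpos ⟨k, hk⟩
    obtain ⟨M, -, hTM⟩ := exists_epoch hK (by omega : 0 < T)
    have hreg := h.pseudoRegret_le hK hν hb hTM
    simp only [hzero, zero_mul, Finset.sum_const_zero, integral_zero] at hreg
    -- With no positive gap the regret is at most `0`; the last term vanishes since division by `0`
    -- gives `0`, and the corruption is nonnegative.
    rw [hset, hfilter]
    simp only [Finset.sum_empty, div_zero, add_zero]
    linarith
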